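/- Conventions. Let $\mu$ be a $\sigma$-finite positive measure on $\mathbb R$, not concentrated on a single point, with $L(\theta)=\int e^{\theta u}\,\mu(du)<\infty$ for all $\theta$ in a non-empty open interval $(C,D)$, $-\infty\le C<D\le\infty$, and let $\kappa=\ln L$. The exponential family generated by $\mu$ is $\mathcal F(\mu)=\{P_\theta(du)=e^{\theta u-\kappa(\theta)}\mu(du):\theta\in(C,D)\}$. Its domain of means is $\kappa'((C,D))$; with $\psi$ the inverse of $\kappa'$ on $(C,D)$, put $W(m,du)=P_{\psi(m)}(du)$ (the member with mean $m$) and call $V(m)=\int(u-m)^2\,W(m,du)$ its variance function. For $z>0$ let $K_1(z)=\lim_{\nu\to1}\frac{\pi}{2}\,\frac{I_{-\nu}(z)-I_\nu(z)}{\sin(\pi\nu)}$, where $I_\nu(z)=\sum_{n\ge0}\frac{(z/2)^{\nu+2n}}{n!\,\Gamma(n+\nu+1)}$. Theorem. Let $\lambda>0$ and $\varepsilon>0$. There is an exponential family with domain of means $\mathbb R$ and variance function $$V(m)=\frac1\lambda(1+\varepsilon m^2)\sqrt{1+\varepsilon m^2},\qquad m\in\mathbb R.$$ Every exponential family with this domain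 of means and variance function consists of infinitely divisible probability laws, and consists exactly of the laws $W(m,du)$, $m\in\mathbb R$, with the densities (with respect to Lebesgue measure $du$ on $\mathbb R$) $$\exp\left(\frac{\lambda}{\varepsilon}\cdot\frac{1+um\varepsilon}{\sqrt{1+\varepsilon m^2}}\right)\frac{\lambda}{\pi\sqrt{\varepsilon}\,\sqrt{1+\varepsilon u^2}}\;K_1\!\left(\frac{\lambda}{\varepsilon}\sqrt{1+\varepsilon u^2}\right),$$ the law with this density being the member $W(m,du)$ with mean $m$. -/

import Mathlib

open Real Set Filter Topology MeasureTheory ProbabilityTheory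

noncomputable section

namespace EpsGaussian

/-- The modified Bessel function of the first kind,
`I_ν(z) = ∑_{n ≥ 0} (z/2)^(ν+2n) / (n! Γ(n+ν+1))`, for real order `ν` and `z > 0`.
(`Real.Gamma` is `0` at its poles and `x / 0 = 0`, so the terms in which `1/Γ` vanishes are `0`.) -/
def besselI (ν z : ℝ) : ℝ :=
  ∑' n : ℕ, (z / 2) ^ (ν + 2 * (n : ℝ)) / ((n.factorial : ℝ) * Real.Gamma ((n : ℝ) + ν + 1))

/-- The modified Bessel function of the second kind,
`K_ν(z) = (π/2) (I_{-ν}(z) - I_ν(z)) / sin(πν)` for `z > 0`, where for integer `ν` the right-hand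
side is understood as the limit in the order. (The quotient is continuous in the order at every
non-integer `ν`, so taking the limit there too does not change its value.) -/
def besselK (ν z : ℝ) : ℝ :=
  limUnder (𝓝[≠] ν) fun s : ℝ => π / 2 * ((besselI (-s) z - besselI s z) / Real.sin (π * s))

/-- The `n`-fold convolution power of a measure on `ℝ`. -/
def convPow (ν : Measure ℝ) : ℕ → Measure ℝ
  | 0 => Measure.dirac 0
  | n + 1 => (convPow ν n).conv ν

/-- Infinite divisibility of a probability law on `ℝ`. -/
def InfinitelyDivisible (P : Measure ℝ) : Prop :=
  IsProbabilityMeasure P ∧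
    ∀ n : ℕ, 1 ≤ n → ∃ ν : Measure ℝ, IsProbabilityMeasure ν ∧ convPow ν n = P

/-- The real points of the open interval `(C, D)`, whose endpoints may be infinite. -/
def paramSet (C D : EReal) : Set ℝ := {θ : ℝ | C < (θ : EReal) ∧ (θ : EReal) < D}

/-- `μ` is a non-degenerate (not concentrated on one point) `σ`-finite measure on `ℝ` with
`L(θ) = ∫ exp(θu) μ(du) < ∞` for all `θ` in the non-empty open interval `(C, D)`. -/
structure IsGenerator (μ : Measure ℝ) (C D : EReal) : Prop where
  sigmaFinite : SigmaFinite μ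
  nondegenerate : ∀ a : ℝ, μ {a}ᶜ ≠ 0
  interval : C < D
  expMoment : ∀ θ ∈ paramSet C D, Integrable (fun u : ℝ => Real.exp (θ * u)) μ

/-- `κ(θ) = log L(θ) = log ∫ exp(θu) μ(du)`. -/
def kappa (μ : Measure ℝ) : ℝ → ℝ := cgf id μ

/-- `P_θ(du) = exp(θu - κ(θ)) μ(du) = (exp(θu) / L(θ)) μ(du)`. -/
def member (μ : Measure ℝ) (θ : ℝ) : Measure ℝ := μ.tilted fun u => θ * u

/-- The exponential family `{P_θ : θ ∈ (C, D)}` generated by `μ`. -/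
def expFamily (μ : Measure ℝ) (C D : EReal) : Set (Measure ℝ) := member μ '' paramSet C D

/-- The domain of the means, `κ'((C, D))`. -/
def meanDomain (μ : Measure ℝ) (C D : EReal) : Set ℝ := deriv (kappa μ) '' paramSet C D

/-- The inverse `ψ` of `κ' : (C, D) → meanDomain`. -/
def psi (μ : Measure ℝ) (C D : EReal) : ℝ → ℝ :=
  Function.invFunOn (deriv (kappa μ)) (paramSet C D)

/-- The parametrization by the means, `W(m, du) = P_{ψ(m)}(du)`. -/
def meanMember (μ : Measure ℝ) (C D : EReal) (m : ℝ) : Measure ℝ := member μ (psi μ C D m)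

/-- The variance function `m ↦ ∫ (u - m)² W(m, du)`. -/
def varianceFunction (μ : Measure ℝ) (C D : EReal) (m : ℝ) : ℝ :=
  ∫ u, (u - m) ^ 2 ∂(meanMember μ C D m)

/-- `μ` generates, with parameters in `(C, D)`, an exponential family whose domain of the means is
`M` and whose variance function is `V` on `M`. -/
structure HasVarianceFunction (μ : Measure ℝ) (C D : EReal) (M : Set ℝ) (V : ℝ → ℝ) : Prop
    extends IsGenerator μ C D where
  meanDomain_eq : meanDomain μ C D = M
  variance_eq : ∀ m ∈ M, varianceFunction μ C D m = V m

/-- The variance function `(1/λ) (1 + ε m²) √(1 + ε m²)`. -/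
def epsGaussianVariance (lam ε m : ℝ) : ℝ := 1 / lam * ((1 + ε * m ^ 2) * √(1 + ε * m ^ 2))

/-- The density (in `u`, with respect to Lebesgue measure) of the member with mean `m`. -/
def epsGaussianDensity (lam ε m u : ℝ) : ℝ :=
  Real.exp (lam / ε * ((1 + u * m * ε) / √(1 + ε * m ^ 2))) *
    (lam / (π * √ε * √(1 + ε * u ^ 2))) * besselK 1 (lam / ε * √(1 + ε * u ^ 2))

/-- The law on `ℝ` with that density. -/
def epsGaussianLaw (lam ε m : ℝ) : Measure ℝ :=
  volume.withDensity fun u => ENNReal.ofReal (epsGaussianDensity lam ε m u)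

end EpsGaussian

end

/-!
The laws in question are the normal inverse Gaussian laws. Write `β(m) = λm / √(1 + εm²)`
(`canonicalParam`). The density with mean `m` is `exp(λ / (ε√(1 + εm²))) exp(β(m) u) k(u)` with a
density `k` that does not depend on `m` (`baseDensity`), so these laws form an exponential family as
soon as the Laplace transform of `k` is known; it is `exp(-√(λ² - εθ²) / ε)` for `εθ² < λ²`
(`lintegral_exp_mul_baseDensity`). This rests on two facts.

* `K_1(z) = (z/4) J(-1, z²/4)` with `J(μ, x) = ∫_0^∞ t^(μ-1) exp(-t - x/t) dt` (`besselK_one`).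
  Since `K_1` is defined as a limit in the order, the corresponding identity is needed for all
  non-integer orders near `1`. For `0 < μ < 1` the functions `J(μ, ·)` and `J(1-μ, ·)`, and likewise
  the two combinations of Bessel series they should equal, solve the first-order system
  `f' = -x^(μ-1) g`, `g' = -x^(-μ) f` with the limits `Γ(μ)`, `Γ(1-μ)` at `0`, and an energy estimate
  shows that such a solution is unique (`eq_zero_of_hasDerivAt_rpow_mul`). Orders in `(1, 2)` follow
  by differentiation, the order `1` by continuity.
* With this formula `k` is a mixture of centered Gaussian densities. Integrating in `u` first leaves
  the inverse Gaussian integral, that is `J(1/2, x) = √π exp(-2√x)` (`besselIntegral_half`).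

Infinite divisibility is read off from the Laplace transform: the law with parameters `(λ, ε, m)` is
the `n`-th convolution power of the one with parameters `(nλ, n²ε, m/n)`
(`convPow_epsGaussianLaw`).

Conversely, in a family with domain of the means `ℝ` and variance function `V` the cumulant function
satisfies `κ'' = V(κ')`. As `β' = 1/V`, the function `β ∘ κ'` is a translation
(`canonicalParam_deriv_kappa`). This determines the parameter interval and, up to a translation and
an additive constant, `κ`; hence the Laplace transform near `0` of the member with mean `0`, and so
that member itself (`ext_of_lintegral_exp_eq`), of which the other members are exponential tilts.
-/

namespace EpsGaussian

/-! ### Exponential-type series and the modified Bessel function `I_ν` -/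

/-- The power series `∑ c_n xⁿ / n!` may be differentiated term by term, which shifts its
coefficients, as soon as these are bounded. -/
theorem hasDerivAt_tsum_mul_pow_div_factorial {c : ℕ → ℝ} {B : ℝ} (hc : ∀ n, |c n| ≤ B) (x : ℝ) :
    HasDerivAt (fun x : ℝ => ∑' n : ℕ, c n * (x ^ n / n.factorial))
      (∑' n : ℕ, c (n + 1) * (x ^ n / n.factorial)) x := by
  have hsum : ∀ (d : ℕ → ℝ), (∀ n, |d n| ≤ B) → ∀ y : ℝ,
      Summable fun n : ℕ => d n * (y ^ n / n.factorial) := by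
    intro d hd y
    refine Summable.of_norm_bounded ((Real.summable_pow_div_factorial |y|).mul_left B) fun n => ?_
    rw [norm_mul, norm_div, norm_pow, Real.norm_natCast]
    exact mul_le_mul_of_nonneg_right (hd n) (by positivity)
  have hterm : ∀ (n : ℕ) (y : ℝ), HasDerivAt (fun y : ℝ => c n * (y ^ n / n.factorial))
      (c n * (n * y ^ (n - 1) / n.factorial)) y := fun n y =>
    ((hasDerivAt_pow n y).div_const _).const_mul _
  have hshift : ∀ (n : ℕ) (y : ℝ),
      ((n + 1 : ℕ) : ℝ) * y ^ (n + 1 - 1) / ((n + 1).factorial : ℝ) = y ^ n / n.factorial := by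
    intro n y
    have : (n.factorial : ℝ) ≠ 0 := by positivity
    rw [Nat.factorial_succ]
    rw [Nat.add_sub_cancel]
    push_cast
    field_simp
  set R := |x| + 1 with hR
  have hu : Summable fun n : ℕ => B * (n * R ^ (n - 1) / n.factorial) := by
    rw [← summable_nat_add_iff 1]
    simp only [hshift]
    exact (Real.summable_pow_div_factorial R).mul_left B
  have key := hasDerivAt_tsum_of_isPreconnected (𝕜 := ℝ)
    (g := fun n (y : ℝ) => c n * (y ^ n / n.factorial))
    (g' := fun n (y : ℝ) => c n * (n * y ^ (n - 1) / n.factorial))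
    (t := Metric.ball 0 R) (y₀ := 0) (y := x) hu
    Metric.isOpen_ball (convex_ball (0 : ℝ) R).isPreconnected (fun n y _ => hterm n y)
    (fun n y hy => by
      have hy' : |y| ≤ R := by simpa using (mem_ball_zero_iff.1 hy).le
      rw [norm_mul, norm_div, norm_mul, norm_pow, Real.norm_natCast, Real.norm_natCast]
      have : |y| ^ (n - 1) ≤ R ^ (n - 1) := by gcongr
      have hB : 0 ≤ B := (abs_nonneg _).trans (hc 0)
      have h1 := hc n
      rw [Real.norm_eq_abs, Real.norm_eq_abs]
      gcongr)
    (by simp [hR]; positivity) (hsum c hc 0) (by simp [hR])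
  refine key.congr_deriv ?_
  rw [Summable.tsum_eq_zero_add]
  · simp only [hshift]; simp
  · rw [← summable_nat_add_iff 1]
    simp only [hshift]
    exact hsum _ (fun n => hc (n + 1)) x

theorem exists_abs_inv_Gamma_le (ν : ℝ) : ∃ B, ∀ n : ℕ, |(Real.Gamma (n + ν + 1))⁻¹| ≤ B := by
  obtain ⟨N, hN⟩ := exists_nat_ge |ν|
  -- beyond `N` the arguments are at least `1`, where `Γ (y + 1) = y Γ y ≥ Γ y`
  have hstep : ∀ n : ℕ, N ≤ n →
      |(Real.Gamma (n + ν + 1))⁻¹| ≤ |(Real.Gamma (N + ν + 1))⁻¹| := by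
    intro n hn
    induction n, hn using Nat.le_induction with
    | base => exact le_rfl
    | succ n hn ih =>
      have h1 : (N : ℝ) ≤ n := by exact_mod_cast hn
      have h2 : 1 ≤ (n : ℝ) + ν + 1 := by linarith [neg_abs_le ν]
      refine le_trans ?_ ih
      have : ((n + 1 : ℕ) : ℝ) + ν + 1 = (n + ν + 1) + 1 := by push_cast; ring
      rw [this, Real.Gamma_add_one (by linarith), mul_inv, abs_mul]
      refine mul_le_of_le_one_left (abs_nonneg _) ?_
      rw [abs_inv, abs_of_pos (by linarith)]
      exact inv_le_one_of_one_le₀ h2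
  refine ⟨∑ i ∈ Finset.range (N + 1), |(Real.Gamma (i + ν + 1))⁻¹|, fun n => ?_⟩
  have hle : ∀ i ≤ N, |(Real.Gamma (i + ν + 1))⁻¹| ≤
      ∑ i ∈ Finset.range (N + 1), |(Real.Gamma (i + ν + 1))⁻¹| := fun i hi =>
    Finset.single_le_sum (f := fun i : ℕ => |(Real.Gamma (i + ν + 1))⁻¹|)
      (fun _ _ => abs_nonneg _) (by simp; omega)
  rcases le_total n N with h | h
  · exact hle n h
  · exact (hstep n h).trans (hle N le_rfl)

/-- The entire part of the modified Bessel function `I_ν`: the series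
`∑ xⁿ / (n! Γ(n + ν + 1))`, for which `I_ν(z) = (z/2)^ν * besselSeries ν (z²/4)`. -/
noncomputable def besselSeries (ν x : ℝ) : ℝ :=
  ∑' n : ℕ, (Real.Gamma (n + ν + 1))⁻¹ * (x ^ n / n.factorial)

theorem besselI_eq (ν : ℝ) {z : ℝ} (hz : 0 < z) :
    besselI ν z = (z / 2) ^ ν * besselSeries ν (z ^ 2 / 4) := by
  rw [besselI, besselSeries, ← tsum_mul_left]
  refine tsum_congr fun n => ?_
  have h : (z / 2) ^ (2 * (n : ℝ)) = (z ^ 2 / 4) ^ n := by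
    rw [Real.rpow_mul (by positivity), Real.rpow_natCast,
      show (2 : ℝ) = ((2 : ℕ) : ℝ) by norm_num, Real.rpow_natCast]
    congr 1
    push_cast
    ring
  rw [Real.rpow_add (by positivity), h, div_eq_mul_inv, mul_inv]
  ring

theorem besselSeries_zero (ν : ℝ) : besselSeries ν 0 = (Real.Gamma (ν + 1))⁻¹ := by
  rw [besselSeries, tsum_eq_single 0]
  · simp
  · intro n hn
    simp [hn]

theorem hasDerivAt_besselSeries (ν x : ℝ) :
    HasDerivAt (besselSeries ν) (besselSeries (ν + 1) x) x := by
  obtain ⟨B, hB⟩ := exists_abs_inv_Gamma_le ν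
  refine (hasDerivAt_tsum_mul_pow_div_factorial hB x).congr_deriv ?_
  rw [besselSeries]
  refine tsum_congr fun n => ?_
  push_cast
  ring_nf

theorem summable_besselSeries (ν x : ℝ) :
    Summable fun n : ℕ => (Real.Gamma (n + ν + 1))⁻¹ * (x ^ n / n.factorial) := by
  obtain ⟨B, hB⟩ := exists_abs_inv_Gamma_le ν
  refine Summable.of_norm_bounded ((Real.summable_pow_div_factorial |x|).mul_left B) fun n => ?_
  rw [norm_mul, norm_div, norm_pow, Real.norm_natCast]
  exact mul_le_mul_of_nonneg_right (hB n) (by positivity)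

/-- The contiguity relation of the series, from `(n + ν) / Γ(n + ν + 1) = 1 / Γ(n + ν)`. -/
theorem besselSeries_sub_one {ν : ℝ} (hν : ∀ n : ℕ, (n : ℝ) + ν ≠ 0) (x : ℝ) :
    besselSeries (ν - 1) x = ν * besselSeries ν x + x * besselSeries (ν + 1) x := by
  have hx : x * besselSeries (ν + 1) x =
      ∑' n : ℕ, (n : ℝ) * ((Real.Gamma (n + ν + 1))⁻¹ * (x ^ n / n.factorial)) := by
    have hf : ∀ n : ℕ, ((n + 1 : ℕ) : ℝ) * ((Real.Gamma ((n + 1 : ℕ) + ν + 1))⁻¹ *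
        (x ^ (n + 1) / (n + 1).factorial)) =
        x * ((Real.Gamma (n + (ν + 1) + 1))⁻¹ * (x ^ n / n.factorial)) := by
      intro n
      rw [Nat.factorial_succ, show ((n + 1 : ℕ) : ℝ) + ν + 1 = n + (ν + 1) + 1 by push_cast; ring]
      have : (n.factorial : ℝ) ≠ 0 := by positivity
      have : ((n : ℝ) + 1) ≠ 0 := by positivity
      push_cast
      field_simp
      ring
    rw [Summable.tsum_eq_zero_add]
    · simp only [hf, tsum_mul_left, besselSeries]
      simp
    · rw [← summable_nat_add_iff 1]
      simp only [hf]
      exact (summable_besselSeries _ x).mul_left x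
  have hs : Summable fun n : ℕ =>
      (n : ℝ) * ((Real.Gamma (n + ν + 1))⁻¹ * (x ^ n / n.factorial)) := by
    have h1 := (summable_besselSeries (ν - 1) x).sub ((summable_besselSeries ν x).mul_left ν)
    refine h1.congr fun n => ?_
    rw [show (n : ℝ) + (ν - 1) + 1 = n + ν by ring, Real.Gamma_add_one (hν n), mul_inv]
    field_simp [hν n]
    ring
  rw [hx, besselSeries, besselSeries, ← tsum_mul_left,
    ← ((summable_besselSeries ν x).mul_left ν).tsum_add hs]
  refine tsum_congr fun n => ?_
  rw [show (n : ℝ) + (ν - 1) + 1 = n + ν by ring, Real.Gamma_add_one (hν n), mul_inv]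
  field_simp [hν n]
  ring

theorem hasDerivAt_rpow_mul_besselSeries {ν : ℝ} (hν : ∀ n : ℕ, (n : ℝ) + ν ≠ 0) {x : ℝ}
    (hx : 0 < x) :
    HasDerivAt (fun x : ℝ => x ^ ν * besselSeries ν x) (x ^ (ν - 1) * besselSeries (ν - 1) x) x := by
  refine ((Real.hasDerivAt_rpow_const (p := ν) (Or.inl hx.ne')).mul
    (hasDerivAt_besselSeries ν x)).congr_deriv ?_
  rw [besselSeries_sub_one hν, Real.rpow_sub_one hx.ne']
  field_simp

/-! ### The integral `∫ t^(μ-1) exp(-t - x/t) dt` -/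

/-- The integral `J(μ, x) = ∫_0^∞ t^(μ-1) exp(-t - x/t) dt`, a deformation of `Γ(μ)` that converges
for all real `μ` when `x > 0`. It equals `2 x^(μ/2) K_μ(2√x)`. -/
noncomputable def besselIntegral (μ x : ℝ) : ℝ :=
  ∫ t in Ioi (0 : ℝ), t ^ (μ - 1) * Real.exp (-t - x / t)

theorem measurable_besselIntegrand (μ x : ℝ) :
    Measurable fun t : ℝ => t ^ (μ - 1) * Real.exp (-t - x / t) := by
  fun_prop

theorem integrableOn_besselIntegrand (μ : ℝ) {x : ℝ} (hx : 0 < x) :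
    IntegrableOn (fun t : ℝ => t ^ (μ - 1) * Real.exp (-t - x / t)) (Ioi 0) := by
  obtain ⟨n, hn⟩ := exists_nat_gt (-μ)
  have hg : IntegrableOn (fun t : ℝ => n.factorial / x ^ n * (Real.exp (-t) * t ^ (μ + n - 1)))
      (Ioi 0) :=
    (Real.GammaIntegral_convergent (s := μ + n) (by linarith)).const_mul _
  refine Integrable.mono' hg (measurable_besselIntegrand μ x).aestronglyMeasurable ?_
  filter_upwards [ae_restrict_mem measurableSet_Ioi] with t (ht : 0 < t)
  -- the singularity at `0` is absorbed by `exp (-x/t) ≤ n! (t/x)^n`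
  have h1 : Real.exp (-(x / t)) ≤ n.factorial / x ^ n * t ^ n := by
    have h := Real.pow_div_factorial_le_exp (x / t) (by positivity) n
    rw [Real.exp_neg, inv_le_comm₀ (by positivity) (by positivity)]
    refine le_trans (le_of_eq ?_) h
    rw [div_pow]
    field_simp
  rw [Real.norm_of_nonneg (by positivity), sub_eq_add_neg (-t), Real.exp_add,
    show μ + n - 1 = (μ - 1) + n by ring, Real.rpow_add ht, Real.rpow_natCast]
  calc t ^ (μ - 1) * (Real.exp (-t) * Real.exp (-(x / t)))
      ≤ t ^ (μ - 1) * (Real.exp (-t) * (n.factorial / x ^ n * t ^ n)) := by gcongr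
    _ = _ := by ring

theorem besselIntegral_pos (μ : ℝ) {x : ℝ} (hx : 0 < x) : 0 < besselIntegral μ x := by
  refine (setIntegral_pos_iff_support_of_nonneg_ae ?_ (integrableOn_besselIntegrand μ hx)).2 ?_
  · filter_upwards [ae_restrict_mem measurableSet_Ioi] with t (ht : 0 < t)
    simp only [Pi.zero_apply]
    positivity
  · have : Ioi (0 : ℝ) ⊆ Function.support fun t : ℝ => t ^ (μ - 1) * Real.exp (-t - x / t) := by
      intro t (ht : 0 < t)
      exact (show 0 < t ^ (μ - 1) * Real.exp (-t - x / t) by positivity).ne'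
    rw [inter_eq_right.2 this]
    simp

theorem hasDerivAt_besselIntegral (μ : ℝ) {x : ℝ} (hx : 0 < x) :
    HasDerivAt (besselIntegral μ) (-besselIntegral (μ - 1) x) x := by
  have key := hasDerivAt_integral_of_dominated_loc_of_deriv_le (𝕜 := ℝ)
    (μ := volume.restrict (Ioi (0 : ℝ))) (x₀ := x) (s := Ioi (x / 2))
    (F := fun x t => t ^ (μ - 1) * Real.exp (-t - x / t))
    (F' := fun x t => -(t ^ (μ - 1 - 1) * Real.exp (-t - x / t)))
    (bound := fun t => t ^ (μ - 1 - 1) * Real.exp (-t - (x / 2) / t))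
    (Ioi_mem_nhds (by linarith))
    (Eventually.of_forall fun y => (measurable_besselIntegrand μ y).aestronglyMeasurable)
    (integrableOn_besselIntegrand μ hx)
    (measurable_besselIntegrand (μ - 1) x).neg.aestronglyMeasurable
    (by
      filter_upwards [ae_restrict_mem measurableSet_Ioi] with t (ht : 0 < t) y (hy : x / 2 < y)
      rw [norm_neg, Real.norm_of_nonneg (by positivity)]
      gcongr)
    (integrableOn_besselIntegrand (μ - 1) (by linarith))
    (by
      filter_upwards [ae_restrict_mem measurableSet_Ioi] with t (ht : 0 < t) y _
      have h1 : HasDerivAt (fun y : ℝ => -t - y / t) (-(1 / t)) y := by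
        simpa using ((hasDerivAt_id y).div_const t).const_sub (-t)
      refine (h1.exp.const_mul (t ^ (μ - 1))).congr_deriv ?_
      rw [Real.rpow_sub_one ht.ne' (μ - 1)]
      ring)
  refine key.2.congr_deriv ?_
  rw [integral_neg, besselIntegral]

/-- The reflection formula, which corresponds to `K_{-μ} = K_μ`. -/
theorem besselIntegral_neg (μ : ℝ) {x : ℝ} (hx : 0 < x) :
    besselIntegral (-μ) x = x ^ (-μ) * besselIntegral μ x := by
  -- substitute `t = x / s`
  rw [besselIntegral, ← integral_comp_rpow_Ioi _ (p := -1) (by norm_num)]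
  have h := integral_comp_mul_left_Ioi
    (fun t : ℝ => (|(-1 : ℝ)| * t ^ ((-1 : ℝ) - 1)) •
      ((t ^ (-1 : ℝ)) ^ (-μ - 1) * Real.exp (-(t ^ (-1 : ℝ)) - x / t ^ (-1 : ℝ)))) 0
    (inv_pos.2 hx)
  rw [mul_zero, smul_eq_mul, inv_inv] at h
  have h2 := congrArg (fun r => x⁻¹ * r) h
  simp only [inv_mul_cancel_left₀ hx.ne'] at h2
  rw [← h2, besselIntegral, ← integral_const_mul, ← integral_const_mul]
  refine setIntegral_congr_fun measurableSet_Ioi fun t (ht : 0 < t) => ?_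
  have hxt : 0 < x⁻¹ * t := by positivity
  simp only [abs_neg, abs_one, one_mul, smul_eq_mul]
  rw [← Real.rpow_mul hxt.le, Real.rpow_neg_one, ← mul_assoc ((x⁻¹ * t) ^ ((-1 : ℝ) - 1)),
    ← Real.rpow_add hxt]
  rw [show ((-1 : ℝ) - 1 + -1 * (-μ - 1)) = μ - 1 by ring,
    Real.mul_rpow (by positivity) ht.le, Real.inv_rpow hx.le, Real.rpow_sub_one hx.ne',
    Real.rpow_neg hx.le]
  have e : -(x⁻¹ * t)⁻¹ - x / (x⁻¹ * t)⁻¹ = -t - x / t := by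
    field_simp
    ring
  rw [e]
  field_simp

theorem tendsto_besselIntegral_zero {μ : ℝ} (hμ : 0 < μ) :
    Tendsto (besselIntegral μ) (𝓝[>] 0) (𝓝 (Real.Gamma μ)) := by
  rw [Real.Gamma_eq_integral hμ]
  refine tendsto_integral_filter_of_dominated_convergence
    (fun t => Real.exp (-t) * t ^ (μ - 1)) ?_ ?_ (Real.GammaIntegral_convergent hμ) ?_
  · exact Eventually.of_forall fun y => (measurable_besselIntegrand μ y).aestronglyMeasurable
  · filter_upwards [self_mem_nhdsWithin] with x (hx : 0 < x)
    filter_upwards [ae_restrict_mem measurableSet_Ioi] with t (ht : 0 < t)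
    rw [Real.norm_of_nonneg (by positivity), mul_comm]
    have : 0 < x / t := by positivity
    gcongr
    linarith
  · filter_upwards [ae_restrict_mem measurableSet_Ioi] with t (ht : 0 < t)
    refine tendsto_nhdsWithin_of_tendsto_nhds ?_
    have : Continuous fun x : ℝ => t ^ (μ - 1) * Real.exp (-t - x / t) := by fun_prop
    convert this.tendsto 0 using 2
    rw [zero_div, sub_zero, mul_comm]

/-- Continuity of `besselIntegral` in the order, at `1`. -/
theorem tendsto_besselIntegral_one {x : ℝ} (hx : 0 < x) :
    Tendsto (fun μ => besselIntegral μ x) (𝓝 1) (𝓝 (besselIntegral 1 x)) := by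
  refine tendsto_integral_filter_of_dominated_convergence
    (fun t => t ^ ((2 : ℝ) - 1) * Real.exp (-t - x / t) + t ^ ((0 : ℝ) - 1) * Real.exp (-t - x / t))
    ?_ ?_ ((integrableOn_besselIntegrand 2 hx).add (integrableOn_besselIntegrand 0 hx)) ?_
  · exact Eventually.of_forall fun μ => (measurable_besselIntegrand μ x).aestronglyMeasurable
  · filter_upwards [Ioo_mem_nhds (a := (0 : ℝ)) (b := 2) zero_lt_one one_lt_two] with μ hμ
    filter_upwards [ae_restrict_mem measurableSet_Ioi] with t (ht : 0 < t)
    rw [Real.norm_of_nonneg (by positivity), ← add_mul]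
    gcongr
    rcases le_total 1 t with h | h
    · have h1 : t ^ (μ - 1) ≤ t ^ ((2 : ℝ) - 1) :=
        Real.rpow_le_rpow_of_exponent_le h (by linarith [hμ.2])
      have h2 : 0 < t ^ ((0 : ℝ) - 1) := by positivity
      linarith
    · have h1 : t ^ (μ - 1) ≤ t ^ ((0 : ℝ) - 1) :=
        Real.rpow_le_rpow_of_exponent_ge ht h (by linarith [hμ.1])
      have h2 : 0 < t ^ ((2 : ℝ) - 1) := by positivity
      linarith
  · filter_upwards [ae_restrict_mem measurableSet_Ioi] with t (ht : 0 < t)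
    have : Continuous fun μ : ℝ => t ^ (μ - 1) * Real.exp (-t - x / t) :=
      (continuous_const.rpow (by fun_prop) fun _ => Or.inl ht.ne').mul continuous_const
    exact this.tendsto 1

/-- For `μ = 1/2` the integral is elementary: the reflection `μ ↦ -μ` turns the derivative formula
into the differential equation `J' = -J / √x`. -/
theorem besselIntegral_half {x : ℝ} (hx : 0 < x) :
    besselIntegral (1 / 2) x = √π * Real.exp (-(2 * √x)) := by
  have hderiv : ∀ y ∈ Ioi (0 : ℝ), HasDerivAt
      (fun y => Real.exp (2 * √y) * besselIntegral (1 / 2) y) 0 y := by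
    intro y (hy : 0 < y)
    have h1 := hasDerivAt_besselIntegral (1 / 2) hy
    rw [show (1 / 2 : ℝ) - 1 = -(1 / 2) by norm_num, besselIntegral_neg _ hy, Real.rpow_neg hy.le,
      ← Real.sqrt_eq_rpow] at h1
    have h2 := ((Real.hasDerivAt_sqrt hy.ne').const_mul 2).exp
    refine (h2.mul h1).congr_deriv ?_
    have : √y ≠ 0 := (Real.sqrt_pos.2 hy).ne'
    field_simp
    ring
  have hconst : ∀ y ∈ Ioi (0 : ℝ), Real.exp (2 * √y) * besselIntegral (1 / 2) y =
      Real.exp (2 * √x) * besselIntegral (1 / 2) x := fun y hy =>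
    (convex_Ioi (0 : ℝ)).is_const_of_fderivWithin_eq_zero (𝕜 := ℝ)
      (f := fun y => Real.exp (2 * √y) * besselIntegral (1 / 2) y)
      (fun z hz => (hderiv z hz).differentiableAt.differentiableWithinAt)
      (fun z hz => by
        rw [fderivWithin_of_isOpen isOpen_Ioi hz]
        ext
        simpa using (hderiv z hz).deriv) hy hx
  have hlim : Tendsto (fun y => Real.exp (2 * √y) * besselIntegral (1 / 2) y) (𝓝[>] 0)
      (𝓝 (√π)) := by
    have h1 : Tendsto (fun y => Real.exp (2 * √y)) (𝓝[>] 0) (𝓝 1) := by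
      refine tendsto_nhdsWithin_of_tendsto_nhds ?_
      have : Continuous fun y : ℝ => Real.exp (2 * √y) := by fun_prop
      simpa using this.tendsto 0
    have h2 := h1.mul (tendsto_besselIntegral_zero (μ := 1 / 2) (by norm_num))
    rwa [Real.Gamma_one_half_eq, one_mul] at h2
  have heq : √π = Real.exp (2 * √x) * besselIntegral (1 / 2) x :=
    tendsto_nhds_unique hlim (tendsto_const_nhds.congr' (by
      filter_upwards [self_mem_nhdsWithin] with y hy using (hconst y hy).symm))
  rw [heq, Real.exp_neg]
  field_simp

/-! ### The integral representation of `K_1` -/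

/-- The combination `π / sin(πμ) (H(-μ, x) - x^μ H(μ, x))` of Bessel series, `H = besselSeries`,
which for non-integer `μ` equals `2 x^(μ/2) K_μ(2√x)` by the definition of `K_μ`. -/
noncomputable def besselCombination (μ x : ℝ) : ℝ :=
  π / Real.sin (π * μ) * (besselSeries (-μ) x - x ^ μ * besselSeries μ x)

theorem hasDerivAt_besselCombination {μ : ℝ} (hμ : ∀ n : ℕ, (n : ℝ) + μ ≠ 0) {x : ℝ} (hx : 0 < x) :
    HasDerivAt (besselCombination μ) (-besselCombination (μ - 1) x) x := by
  refine (((hasDerivAt_besselSeries (-μ) x).sub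
    (hasDerivAt_rpow_mul_besselSeries hμ hx)).const_mul (π / Real.sin (π * μ))).congr_deriv ?_
  rw [besselCombination, show π * (μ - 1) = π * μ - π by ring, Real.sin_sub_pi,
    show -(μ - 1) = -μ + 1 by ring, div_neg]
  ring

theorem besselCombination_neg (μ : ℝ) {x : ℝ} (hx : 0 < x) :
    besselCombination (-μ) x = x ^ (-μ) * besselCombination μ x := by
  have h : x ^ (-μ) * x ^ μ = 1 := by rw [← Real.rpow_add hx]; simp
  rw [besselCombination, besselCombination, mul_neg, Real.sin_neg, neg_neg, div_neg]
  linear_combination (π / Real.sin (π * μ) * besselSeries μ x) * h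

/-- The limit is that of `besselIntegral μ`, by the reflection formula of `Γ`. -/
theorem tendsto_besselCombination_zero {μ : ℝ} (h0 : 0 < μ) (h1 : μ < 1) :
    Tendsto (besselCombination μ) (𝓝[>] 0) (𝓝 (Real.Gamma μ)) := by
  have hH : ∀ ν, Tendsto (besselSeries ν) (𝓝[>] 0) (𝓝 (Real.Gamma (ν + 1))⁻¹) := fun ν => by
    have h := (hasDerivAt_besselSeries ν 0).continuousAt.tendsto
    rw [besselSeries_zero] at h
    exact tendsto_nhdsWithin_of_tendsto_nhds h
  have hpow : Tendsto (fun x : ℝ => x ^ μ) (𝓝[>] 0) (𝓝 0) := by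
    refine tendsto_nhdsWithin_of_tendsto_nhds ?_
    have h := (Real.continuousAt_rpow_const 0 μ (Or.inr h0.le)).tendsto
    rwa [Real.zero_rpow h0.ne'] at h
  have h := ((hH (-μ)).sub (hpow.mul (hH μ))).const_mul (π / Real.sin (π * μ))
  have hG : Real.Gamma (1 - μ) ≠ 0 := (Real.Gamma_pos_of_pos (by linarith)).ne'
  have e : π / Real.sin (π * μ) * ((Real.Gamma (-μ + 1))⁻¹ - 0 * (Real.Gamma (μ + 1))⁻¹) =
      Real.Gamma μ := by
    rw [← Real.Gamma_mul_Gamma_one_sub, zero_mul, sub_zero, show -μ + 1 = 1 - μ by ring,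
      mul_inv_cancel_right₀ hG]
  rwa [e] at h

/-- Uniqueness for the singular first-order system satisfied by `x ↦ J(μ, x)` and
`x ↦ J(1 - μ, x)`: a solution vanishing at `0` vanishes. -/
theorem eq_zero_of_hasDerivAt_rpow_mul {f g : ℝ → ℝ} {μ : ℝ} (h0 : 0 < μ) (h1 : μ < 1)
    (hf : ∀ x, 0 < x → HasDerivAt f (-(x ^ (μ - 1) * g x)) x)
    (hg : ∀ x, 0 < x → HasDerivAt g (-(x ^ (-μ) * f x)) x)
    (hf0 : Tendsto f (𝓝[>] 0) (𝓝 0)) (hg0 : Tendsto g (𝓝[>] 0) (𝓝 0)) {x : ℝ} (hx : 0 < x) :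
    f x = 0 := by
  -- `φ' = x^(μ-1) + x^(-μ)` bounds the logarithmic derivative of the energy `f² + g²`
  set φ : ℝ → ℝ := fun x => x ^ μ / μ + x ^ (1 - μ) / (1 - μ) with hφ
  set E : ℝ → ℝ := fun x => Real.exp (-φ x) * (f x ^ 2 + g x ^ 2) with hE
  have hφd : ∀ x, 0 < x → HasDerivAt φ (x ^ (μ - 1) + x ^ (-μ)) x := by
    intro x hx
    have h1' : (1 - μ) ≠ 0 := by linarith
    refine (((Real.hasDerivAt_rpow_const (p := μ) (Or.inl hx.ne')).div_const μ).add
      ((Real.hasDerivAt_rpow_const (p := 1 - μ) (Or.inl hx.ne')).div_const (1 - μ))).congr_deriv ?_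
    rw [show 1 - μ - 1 = -μ by ring]
    field_simp
  have hEd : ∀ x, 0 < x → HasDerivAt E
      (-(Real.exp (-φ x) * (x ^ (μ - 1) + x ^ (-μ)) * (f x + g x) ^ 2)) x := by
    intro x hx
    refine ((hφd x hx).neg.exp.mul (((hf x hx).pow 2).add ((hg x hx).pow 2))).congr_deriv ?_
    simp only [Pi.neg_apply, Pi.add_apply, Pi.pow_apply]
    push_cast
    ring
  have hanti : AntitoneOn E (Ioi 0) := by
    refine antitoneOn_of_deriv_nonpos (convex_Ioi 0)
      (fun x hx => (hEd x hx).continuousAt.continuousWithinAt)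
      (fun x hx => ((hEd x (interior_subset hx)).differentiableAt).differentiableWithinAt)
      fun x hx => ?_
    have hx' : 0 < x := interior_subset hx
    rw [(hEd x hx').deriv]
    have : 0 ≤ Real.exp (-φ x) * (x ^ (μ - 1) + x ^ (-μ)) * (f x + g x) ^ 2 := by positivity
    linarith
  have hlim : Tendsto E (𝓝[>] 0) (𝓝 0) := by
    have hφ0 : Tendsto φ (𝓝[>] 0) (𝓝 0) := by
      refine tendsto_nhdsWithin_of_tendsto_nhds ?_
      have hc : ContinuousAt φ 0 :=
        ((Real.continuousAt_rpow_const 0 μ (Or.inr h0.le)).div_const μ).add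
          ((Real.continuousAt_rpow_const 0 (1 - μ) (Or.inr (by linarith))).div_const (1 - μ))
      have h := hc.tendsto
      simpa [hφ, Real.zero_rpow h0.ne', Real.zero_rpow (show (1 - μ) ≠ 0 by linarith)] using h
    have h := ((Real.continuous_exp.tendsto _).comp hφ0.neg).mul ((hf0.pow 2).add (hg0.pow 2))
    simpa using h
  have hle : E x ≤ 0 := by
    refine ge_of_tendsto hlim ?_
    filter_upwards [Ioc_mem_nhdsGT hx] with y hy
    exact hanti hy.1 hx hy.2
  have hle' : f x ^ 2 + g x ^ 2 ≤ 0 := by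
    by_contra! h
    have : 0 < E x := by positivity
    linarith
  nlinarith [sq_nonneg (g x), sq_nonneg (f x)]

theorem besselIntegral_eq_besselCombination_of_mem_Ioo {μ : ℝ} (h0 : 0 < μ) (h1 : μ < 1) {x : ℝ}
    (hx : 0 < x) : besselIntegral μ x = besselCombination μ x := by
  set D : ℝ → ℝ → ℝ := fun μ x => besselIntegral μ x - besselCombination μ x with hD
  have hd : ∀ ν, 0 < ν → ν < 1 → ∀ y, 0 < y →
      HasDerivAt (D ν) (-(y ^ (ν - 1) * D (1 - ν) y)) y := by
    intro ν hν _ y hy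
    refine ((hasDerivAt_besselIntegral ν hy).sub
      (hasDerivAt_besselCombination (fun n => by positivity) hy)).congr_deriv ?_
    rw [show ν - 1 = -(1 - ν) by ring, besselIntegral_neg _ hy, besselCombination_neg _ hy]
    ring
  have hl : ∀ ν, 0 < ν → ν < 1 → Tendsto (D ν) (𝓝[>] 0) (𝓝 0) := by
    intro ν hν hν'
    simpa using (tendsto_besselIntegral_zero hν).sub (tendsto_besselCombination_zero hν hν')
  have hd2 := hd (1 - μ) (by linarith) (by linarith)
  simp only [sub_sub_cancel, sub_sub_cancel_left] at hd2
  exact sub_eq_zero.1 (eq_zero_of_hasDerivAt_rpow_mul h0 h1 (hd μ h0 h1) hd2 (hl μ h0 h1)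
    (hl (1 - μ) (by linarith) (by linarith)) hx)

/-- The integral representation of `K_μ` for `μ ≠ 1` on both sides of `1`. -/
theorem besselIntegral_eq_besselCombination {μ : ℝ} (h0 : 0 < μ) (h2 : μ < 2) (h1 : μ ≠ 1) {x : ℝ}
    (hx : 0 < x) : besselIntegral μ x = besselCombination μ x := by
  rcases lt_or_gt_of_ne h1 with h | h
  · exact besselIntegral_eq_besselCombination_of_mem_Ioo h0 h hx
  -- differentiate the identity of order `1 - μ ∈ (-1, 0)`, obtained by reflection
  have heq : ∀ y, 0 < y → besselIntegral (1 - μ) y = besselCombination (1 - μ) y := by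
    intro y hy
    rw [show 1 - μ = -(μ - 1) by ring, besselIntegral_neg _ hy, besselCombination_neg _ hy,
      besselIntegral_eq_besselCombination_of_mem_Ioo (by linarith) (by linarith) hy]
  have hd1 := hasDerivAt_besselIntegral (1 - μ) hx
  have hd2 := hasDerivAt_besselCombination (μ := 1 - μ) (fun n hn => by
    rcases n with _ | n
    · simp at hn; linarith
    · push_cast at hn
      have : (0 : ℝ) ≤ n := Nat.cast_nonneg n
      linarith) hx
  have hd3 := hd1.congr_of_eventuallyEq (f₁ := besselCombination (1 - μ)) (by
    filter_upwards [Ioi_mem_nhds hx] with y hy using (heq y hy).symm)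
  have h4 := hd3.unique hd2
  rw [sub_sub_cancel_left, besselIntegral_neg _ hx, besselCombination_neg _ hx, neg_inj] at h4
  exact mul_left_cancel₀ (by positivity) h4

/-- The integral representation of `K_1`, the limit `μ → 1` of the one of `K_μ`. -/
theorem besselK_one {z : ℝ} (hz : 0 < z) :
    besselK 1 z = z / 4 * besselIntegral (-1) (z ^ 2 / 4) := by
  have hx : 0 < z ^ 2 / 4 := by positivity
  refine Tendsto.limUnder_eq ?_
  have h1 : Tendsto (fun s : ℝ => 1 / 2 * ((z / 2) ^ (-s) * besselIntegral s (z ^ 2 / 4))) (𝓝[≠] 1)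
      (𝓝 (1 / 2 * ((z / 2) ^ (-(1 : ℝ)) * besselIntegral 1 (z ^ 2 / 4)))) := by
    refine tendsto_nhdsWithin_of_tendsto_nhds ?_
    have hc : Continuous fun s : ℝ => (z / 2) ^ (-s) :=
      continuous_const.rpow continuous_neg fun _ => Or.inl (by positivity)
    exact ((hc.tendsto 1).mul (tendsto_besselIntegral_one hx)).const_mul _
  have e : 1 / 2 * ((z / 2) ^ (-(1 : ℝ)) * besselIntegral 1 (z ^ 2 / 4)) =
      z / 4 * besselIntegral (-1) (z ^ 2 / 4) := by
    rw [besselIntegral_neg _ hx, Real.rpow_neg_one, Real.rpow_neg_one]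
    field_simp
  rw [← e]
  refine h1.congr' ?_
  filter_upwards [self_mem_nhdsWithin,
    nhdsWithin_le_nhds (Ioo_mem_nhds (a := (0 : ℝ)) (b := 2) zero_lt_one one_lt_two)] with s hs1 hs
  rw [besselIntegral_eq_besselCombination hs.1 hs.2 hs1 hx, besselCombination, besselI_eq _ hz,
    besselI_eq _ hz]
  have h2 : (z ^ 2 / 4) ^ s = (z / 2) ^ s * (z / 2) ^ s := by
    rw [← Real.mul_rpow (by positivity) (by positivity)]
    congr 1
    ring
  have h3 : (z / 2) ^ (-s) * (z / 2) ^ s = 1 := by rw [← Real.rpow_add (by positivity)]; simp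
  rw [h2]
  linear_combination (-(1 / 2) * (π / Real.sin (π * s)) * (z / 2) ^ s *
    besselSeries s (z ^ 2 / 4)) * h3

/-! ### The Laplace transform of the laws -/

/-- The normalization of the inverse Gaussian density. -/
theorem lintegral_inverseGaussian {p q : ℝ} (hp : 0 < p) (hq : 0 < q) :
    ∫⁻ t in Ioi (0 : ℝ), ENNReal.ofReal (t ^ (-(3 / 2) : ℝ) * Real.exp (-(p * t) - q / t)) =
      ENNReal.ofReal (√(π / q) * Real.exp (-(2 * √(p * q)))) := by
  have hpq : 0 < p * q := by positivity
  have hfun : ∀ t ∈ Ioi (0 : ℝ),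
      (p * t) ^ ((-(1 / 2) : ℝ) - 1) * Real.exp (-(p * t) - p * q / (p * t)) =
        p ^ (-(3 / 2) : ℝ) * (t ^ (-(3 / 2) : ℝ) * Real.exp (-(p * t) - q / t)) := by
    intro t (ht : 0 < t)
    rw [mul_div_mul_left _ _ hp.ne', show (-(1 / 2) : ℝ) - 1 = -(3 / 2) by norm_num,
      Real.mul_rpow hp.le ht.le, mul_assoc]
  have hp' : p ^ (-(3 / 2) : ℝ) ≠ 0 := by positivity
  have hint : IntegrableOn (fun t : ℝ => t ^ (-(3 / 2) : ℝ) * Real.exp (-(p * t) - q / t))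
      (Ioi 0) := by
    have h := (integrableOn_Ioi_comp_mul_left_iff
      (fun t : ℝ => t ^ ((-(1 / 2) : ℝ) - 1) * Real.exp (-t - p * q / t)) 0 hp).2
      (by rw [mul_zero]; exact integrableOn_besselIntegrand _ hpq)
    have h2 := (integrableOn_congr_fun hfun measurableSet_Ioi).1 h
    refine (h2.const_mul (p ^ (-(3 / 2) : ℝ))⁻¹).congr ?_
    exact Eventually.of_forall fun t => by simp only [inv_mul_cancel_left₀ hp']
  rw [← ofReal_integral_eq_lintegral_ofReal hint (by
    filter_upwards [ae_restrict_mem measurableSet_Ioi] with t (ht : 0 < t)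
    simp only [Pi.zero_apply]
    positivity)]
  congr 1
  have h := integral_comp_mul_left_Ioi
    (fun t : ℝ => t ^ ((-(1 / 2) : ℝ) - 1) * Real.exp (-t - p * q / t)) 0 hp
  rw [mul_zero, setIntegral_congr_fun measurableSet_Ioi hfun, integral_const_mul, smul_eq_mul] at h
  change _ = p⁻¹ * besselIntegral (-(1 / 2)) (p * q) at h
  rw [besselIntegral_neg _ hpq, besselIntegral_half hpq] at h
  have e1 : p ^ (-(3 / 2) : ℝ) = p⁻¹ * (√p)⁻¹ := by
    rw [show (-(3 / 2) : ℝ) = -1 + -(1 / 2) by norm_num, Real.rpow_add hp, Real.rpow_neg_one,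
      Real.rpow_neg hp.le, ← Real.sqrt_eq_rpow]
  have e2 : (p * q) ^ (-(1 / 2) : ℝ) = (√p)⁻¹ * (√q)⁻¹ := by
    rw [Real.rpow_neg hpq.le, ← Real.sqrt_eq_rpow, Real.sqrt_mul hp.le, mul_inv]
  rw [e1, e2] at h
  have hsp : √p ≠ 0 := (Real.sqrt_pos.2 hp).ne'
  have hsq : √q ≠ 0 := (Real.sqrt_pos.2 hq).ne'
  rw [Real.sqrt_div Real.pi_pos.le]
  field_simp at h ⊢
  linarith

theorem lintegral_exp_mul_sub_mul_sq (θ : ℝ) {b : ℝ} (hb : 0 < b) :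
    ∫⁻ u : ℝ, ENNReal.ofReal (Real.exp (θ * u - b * u ^ 2)) =
      ENNReal.ofReal (√(π / b) * Real.exp (θ ^ 2 / (4 * b))) := by
  have hfun : ∀ u : ℝ, Real.exp (θ * u - b * u ^ 2) =
      Real.exp (θ ^ 2 / (4 * b)) * Real.exp (-b * (u - θ / (2 * b)) ^ 2) := by
    intro u
    rw [← Real.exp_add]
    congr 1
    field_simp
    ring
  simp only [hfun]
  rw [← ofReal_integral_eq_lintegral_ofReal
    (((integrable_exp_neg_mul_sq hb).comp_sub_right _).const_mul _)
    (Eventually.of_forall fun u => by positivity), integral_const_mul,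
    integral_sub_right_eq_self (fun u : ℝ => Real.exp (-b * u ^ 2)), integral_gaussian, mul_comm]

/-- The unnormalized density `λ / (π √ε √(1 + εu²)) K_1((λ/ε) √(1 + εu²))`, of which every
`epsGaussianDensity lam ε m` is an exponential tilt. -/
noncomputable def baseDensity (lam ε u : ℝ) : ℝ :=
  lam / (π * √ε * √(1 + ε * u ^ 2)) * besselK 1 (lam / ε * √(1 + ε * u ^ 2))

/-- The canonical parameter of the law with mean `m`. -/
noncomputable def canonicalParam (lam ε m : ℝ) : ℝ := lam * m / √(1 + ε * m ^ 2)

variable {lam ε : ℝ}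

theorem baseDensity_eq (hlam : 0 < lam) (hε : 0 < ε) (u : ℝ) :
    baseDensity lam ε u = lam ^ 2 / (4 * π * ε * √ε) *
      besselIntegral (-1) ((lam / ε) ^ 2 * (1 + ε * u ^ 2) / 4) := by
  have hw : 0 < √(1 + ε * u ^ 2) := by positivity
  have hsε : 0 < √ε := by positivity
  rw [baseDensity, besselK_one (by positivity), mul_pow, Real.sq_sqrt (by positivity)]
  field_simp

theorem baseDensity_nonneg (hlam : 0 < lam) (hε : 0 < ε) (u : ℝ) : 0 ≤ baseDensity lam ε u := by
  have := besselIntegral_pos (-1) (x := (lam / ε) ^ 2 * (1 + ε * u ^ 2) / 4) (by positivity)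
  rw [baseDensity_eq hlam hε]
  positivity

theorem continuous_baseDensity (hlam : 0 < lam) (hε : 0 < ε) : Continuous (baseDensity lam ε) := by
  have hJ : ContinuousOn (besselIntegral (-1)) (Ioi 0) := fun x hx =>
    (hasDerivAt_besselIntegral (-1) hx).continuousAt.continuousWithinAt
  have h : Continuous fun u : ℝ => besselIntegral (-1) ((lam / ε) ^ 2 * (1 + ε * u ^ 2) / 4) :=
    hJ.comp_continuous (by fun_prop) fun u => by
      rw [mem_Ioi]
      positivity
  refine (continuous_const.mul h).congr fun u => (baseDensity_eq hlam hε u).symm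

theorem epsGaussianDensity_eq (hε : 0 < ε) (m u : ℝ) :
    epsGaussianDensity lam ε m u = Real.exp (lam / (ε * √(1 + ε * m ^ 2))) *
      (Real.exp (canonicalParam lam ε m * u) * baseDensity lam ε u) := by
  have hw : √(1 + ε * m ^ 2) ≠ 0 := by positivity
  rw [epsGaussianDensity, baseDensity, canonicalParam, ← mul_assoc, ← mul_assoc, ← Real.exp_add]
  congr 3
  field_simp

/-- The Laplace transform of the base density: `K_1` is a mixture of Gaussians in `u`, and the
mixing integral left after integrating in `u` is that of the inverse Gaussian density. -/
theorem lintegral_exp_mul_baseDensity (hlam : 0 < lam) (hε : 0 < ε) {θ : ℝ}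
    (hθ : ε * θ ^ 2 < lam ^ 2) :
    ∫⁻ u, ENNReal.ofReal (Real.exp (θ * u) * baseDensity lam ε u) =
      ENNReal.ofReal (Real.exp (-(√(lam ^ 2 - ε * θ ^ 2) / ε))) := by
  set c : ℝ := lam ^ 2 / (4 * π * ε * √ε) with hc
  set F : ℝ → ℝ → ℝ := fun u t => c * (Real.exp (θ * u) *
    (t ^ ((-1 : ℝ) - 1) * Real.exp (-t - (lam / ε) ^ 2 * (1 + ε * u ^ 2) / 4 / t))) with hF
  have hsε : 0 < √ε := by positivity
  have hc0 : 0 < c := by positivity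
  have h1 : ∀ u, ENNReal.ofReal (Real.exp (θ * u) * baseDensity lam ε u) =
      ∫⁻ t in Ioi (0 : ℝ), ENNReal.ofReal (F u t) := by
    intro u
    have hi := integrableOn_besselIntegrand (-1)
      (x := (lam / ε) ^ 2 * (1 + ε * u ^ 2) / 4) (by positivity)
    rw [← ofReal_integral_eq_lintegral_ofReal ((hi.const_mul _).const_mul _) (by
      filter_upwards [ae_restrict_mem measurableSet_Ioi] with t (ht : 0 < t)
      simp only [Pi.zero_apply]
      positivity), integral_const_mul, integral_const_mul, baseDensity_eq hlam hε, besselIntegral]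
    congr 1
    ring
  simp only [h1]
  rw [lintegral_lintegral_swap (by
    refine Measurable.aemeasurable ?_
    simp only [hF]
    fun_prop)]
  set p : ℝ := (lam ^ 2 - ε * θ ^ 2) / lam ^ 2 with hp
  set q : ℝ := (lam / ε) ^ 2 / 4 with hq
  have hp0 : 0 < p := div_pos (by linarith) (by positivity)
  have hq0 : 0 < q := by positivity
  set C : ℝ := c * (2 * √π * √ε / lam) with hC
  have hC0 : 0 ≤ C := by positivity
  have h2 : ∀ t ∈ Ioi (0 : ℝ), ∫⁻ u, ENNReal.ofReal (F u t) =
      ENNReal.ofReal C *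
        ENNReal.ofReal (t ^ (-(3 / 2) : ℝ) * Real.exp (-(p * t) - q / t)) := by
    intro t (ht : 0 < t)
    have hb : 0 < lam ^ 2 / (4 * ε * t) := by positivity
    have h3 : ∀ u, ENNReal.ofReal (F u t) =
        ENNReal.ofReal (c * t ^ ((-1 : ℝ) - 1) * Real.exp (-t - q / t)) *
          ENNReal.ofReal (Real.exp (θ * u - lam ^ 2 / (4 * ε * t) * u ^ 2)) := by
      intro u
      rw [← ENNReal.ofReal_mul (by positivity)]
      congr 1
      have e : Real.exp (θ * u) * Real.exp (-t - (lam / ε) ^ 2 * (1 + ε * u ^ 2) / 4 / t) =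
          Real.exp (-t - q / t) * Real.exp (θ * u - lam ^ 2 / (4 * ε * t) * u ^ 2) := by
        rw [← Real.exp_add, ← Real.exp_add, hq]
        congr 1
        field_simp
        ring
      simp only [hF]
      linear_combination (c * t ^ ((-1 : ℝ) - 1)) * e
    simp only [h3]
    rw [lintegral_const_mul' _ _ ENNReal.ofReal_ne_top, lintegral_exp_mul_sub_mul_sq θ hb,
      ← ENNReal.ofReal_mul (by positivity), ← ENNReal.ofReal_mul hC0]
    congr 1
    have e1 : √(π / (lam ^ 2 / (4 * ε * t))) = 2 * √π * √ε / lam * √t := by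
      rw [show π / (lam ^ 2 / (4 * ε * t)) = (2 * √π * √ε / lam * √t) ^ 2 by
        rw [mul_pow, div_pow, mul_pow, mul_pow, Real.sq_sqrt Real.pi_pos.le, Real.sq_sqrt hε.le,
          Real.sq_sqrt ht.le]
        field_simp
        norm_num, Real.sqrt_sq (by positivity)]
    have e2 : t ^ (-(3 / 2) : ℝ) = t ^ ((-1 : ℝ) - 1) * √t := by
      rw [Real.sqrt_eq_rpow, ← Real.rpow_add ht]
      norm_num
    have e3 : Real.exp (-(p * t) - q / t) =
        Real.exp (-t - q / t) * Real.exp (θ ^ 2 / (4 * (lam ^ 2 / (4 * ε * t)))) := by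
      rw [← Real.exp_add, hp]
      congr 1
      field_simp
      ring
    rw [e1, e2, e3, hC]
    ring
  rw [setLIntegral_congr_fun measurableSet_Ioi h2,
    lintegral_const_mul' _ _ ENNReal.ofReal_ne_top, lintegral_inverseGaussian hp0 hq0,
    ← ENNReal.ofReal_mul hC0]
  congr 1
  have e1 : √(π / q) = √π * (2 * ε / lam) := by
    rw [hq, show π / ((lam / ε) ^ 2 / 4) = π * (2 * ε / lam) ^ 2 by field_simp; norm_num,
      Real.sqrt_mul Real.pi_pos.le, Real.sqrt_sq (by positivity)]
  have e2 : 2 * √(p * q) = √(lam ^ 2 - ε * θ ^ 2) / ε := by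
    rw [show p * q = (lam ^ 2 - ε * θ ^ 2) / (2 * ε) ^ 2 by rw [hp, hq]; field_simp; norm_num,
      Real.sqrt_div (by linarith), Real.sqrt_sq (by positivity)]
    field_simp
  have hpi : √π ^ 2 = π := Real.sq_sqrt Real.pi_pos.le
  have e3 : C * (√π * (2 * ε / lam)) = 1 := by
    rw [hC, hc]
    field_simp
    rw [hpi]
    ring
  rw [e1, e2, ← mul_assoc, e3, one_mul]

/-! ### Laws determined by their Laplace transform near the origin -/

theorem integrable_exp_of_lintegral_ne_top {P : Measure ℝ} {θ : ℝ}
    (h : ∫⁻ u, ENNReal.ofReal (Real.exp (θ * u)) ∂P ≠ ⊤) :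
    Integrable (fun u : ℝ => Real.exp (θ * u)) P :=
  (lintegral_ofReal_ne_top_iff_integrable (by fun_prop)
    (Eventually.of_forall fun u => (Real.exp_pos _).le)).1 h

/-- Finite measures whose Laplace transforms are finite and agree near `0` are equal: the
complex Laplace transforms agree on a vertical strip around the imaginary axis. -/
theorem ext_of_lintegral_exp_eq {P Q : Measure ℝ} [IsFiniteMeasure P] [IsFiniteMeasure Q]
    (hP : ∀ᶠ θ in 𝓝 (0 : ℝ), ∫⁻ u, ENNReal.ofReal (Real.exp (θ * u)) ∂P ≠ ⊤)
    (h : ∀ᶠ θ in 𝓝 (0 : ℝ), ∫⁻ u, ENNReal.ofReal (Real.exp (θ * u)) ∂P =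
      ∫⁻ u, ENNReal.ofReal (Real.exp (θ * u)) ∂Q) : P = Q := by
  obtain ⟨r, hr, hball⟩ := Metric.eventually_nhds_iff_ball.1 (hP.and h)
  have hsub : ∀ ν : Measure ℝ, (∀ θ ∈ Metric.ball (0 : ℝ) r,
      ∫⁻ u, ENNReal.ofReal (Real.exp (θ * u)) ∂ν ≠ ⊤) →
      Metric.ball (0 : ℝ) r ⊆ interior (integrableExpSet id ν) := fun ν hν =>
    interior_maximal (fun θ hθ => integrable_exp_of_lintegral_ne_top (hν θ hθ))
      Metric.isOpen_ball
  have hIP := hsub P fun θ hθ => (hball θ hθ).1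
  have hIQ := hsub Q fun θ hθ => by rw [← (hball θ hθ).2]; exact (hball θ hθ).1
  have hmgf : ∀ θ ∈ Metric.ball (0 : ℝ) r, mgf id P θ = mgf id Q θ := by
    intro θ hθ
    simp only [mgf, id]
    rw [integral_eq_lintegral_of_nonneg_ae (Eventually.of_forall fun u => (Real.exp_pos _).le)
      (by fun_prop), integral_eq_lintegral_of_nonneg_ae
      (Eventually.of_forall fun u => (Real.exp_pos _).le) (by fun_prop), (hball θ hθ).2]
  have heq : Set.EqOn (complexMGF id P) (complexMGF id Q)
      {z | z.re ∈ Metric.ball (0 : ℝ) r} := by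
    refine AnalyticOnNhd.eqOn_of_preconnected_of_frequently_eq (𝕜 := ℂ)
      (fun z hz => analyticAt_complexMGF (hIP hz)) (fun z hz => analyticAt_complexMGF (hIQ hz))
      ((convex_ball (0 : ℝ) r).linear_preimage Complex.reLm).isPreconnected
      (z₀ := ((0 : ℝ) : ℂ)) (by simpa using hr) ?_
    have hreal : ∃ᶠ (x : ℝ) in 𝓝[≠] 0, complexMGF id P x = complexMGF id Q x := by
      refine Eventually.frequently ?_
      filter_upwards [nhdsWithin_le_nhds (Metric.ball_mem_nhds (0 : ℝ) hr)] with x hx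
      rw [complexMGF_ofReal, complexMGF_ofReal, hmgf x hx]
    have ht : Tendsto (fun x : ℝ => (x : ℂ)) (𝓝[≠] 0) (𝓝[≠] ((0 : ℝ) : ℂ)) := by
      refine tendsto_nhdsWithin_iff.2 ⟨tendsto_nhdsWithin_of_tendsto_nhds
        (Complex.continuous_ofReal.tendsto 0), ?_⟩
      filter_upwards [self_mem_nhdsWithin] with x hx
      simpa using hx
    exact ht.frequently hreal
  refine Measure.ext_of_charFun (funext fun t => ?_)
  rw [← complexMGF_id_mul_I, ← complexMGF_id_mul_I]
  exact heq (by simpa using hr)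

theorem isProbabilityMeasure_convPow {ν : Measure ℝ} [IsProbabilityMeasure ν] (n : ℕ) :
    IsProbabilityMeasure (convPow ν n) := by
  induction n with
  | zero => rw [convPow]; infer_instance
  | succ n ih => rw [convPow]; infer_instance

theorem lintegral_exp_convPow {ν : Measure ℝ} [IsProbabilityMeasure ν] (n : ℕ) (θ : ℝ) :
    ∫⁻ u, ENNReal.ofReal (Real.exp (θ * u)) ∂(convPow ν n) =
      (∫⁻ u, ENNReal.ofReal (Real.exp (θ * u)) ∂ν) ^ n := by
  induction n with
  | zero => simp [convPow, lintegral_dirac]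
  | succ n ih =>
    rw [convPow, Measure.lintegral_conv (by fun_prop), pow_succ, ← ih]
    simp only [mul_add, Real.exp_add, ENNReal.ofReal_mul (Real.exp_pos _).le]
    simp only [lintegral_const_mul' _ _ ENNReal.ofReal_ne_top]
    rw [lintegral_mul_const _ (by fun_prop)]

/-! ### The family of laws -/

theorem sq_sub_canonicalParam_sq (lam : ℝ) (hε : 0 < ε) (m : ℝ) :
    lam ^ 2 - ε * canonicalParam lam ε m ^ 2 = (lam / √(1 + ε * m ^ 2)) ^ 2 := by
  have h : 0 < 1 + ε * m ^ 2 := by positivity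
  rw [canonicalParam, div_pow, div_pow, Real.sq_sqrt h.le]
  field_simp
  ring

theorem canonicalParam_sq_lt (hlam : 0 < lam) (hε : 0 < ε) (m : ℝ) :
    ε * canonicalParam lam ε m ^ 2 < lam ^ 2 := by
  have h := sq_sub_canonicalParam_sq lam hε m
  have : 0 < (lam / √(1 + ε * m ^ 2)) ^ 2 := by positivity
  linarith

theorem measurable_epsGaussianDensity (hlam : 0 < lam) (hε : 0 < ε) (m : ℝ) :
    Measurable (epsGaussianDensity lam ε m) := by
  have h : epsGaussianDensity lam ε m = fun u => Real.exp (lam / (ε * √(1 + ε * m ^ 2))) *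
      (Real.exp (canonicalParam lam ε m * u) * baseDensity lam ε u) :=
    funext fun u => epsGaussianDensity_eq hε m u
  have := (continuous_baseDensity hlam hε).measurable
  rw [h]
  fun_prop

theorem lintegral_exp_epsGaussianLaw (hlam : 0 < lam) (hε : 0 < ε) (m : ℝ) {θ : ℝ}
    (hθ : ε * (canonicalParam lam ε m + θ) ^ 2 < lam ^ 2) :
    ∫⁻ u, ENNReal.ofReal (Real.exp (θ * u)) ∂(epsGaussianLaw lam ε m) =
      ENNReal.ofReal (Real.exp ((lam / √(1 + ε * m ^ 2) -
        √(lam ^ 2 - ε * (canonicalParam lam ε m + θ) ^ 2)) / ε)) := by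
  have h : ∀ u, (fun u => ENNReal.ofReal (epsGaussianDensity lam ε m u)) u *
      ENNReal.ofReal (Real.exp (θ * u)) =
      ENNReal.ofReal (Real.exp (lam / (ε * √(1 + ε * m ^ 2)))) *
        ENNReal.ofReal (Real.exp ((canonicalParam lam ε m + θ) * u) * baseDensity lam ε u) := by
    intro u
    have hb := baseDensity_nonneg hlam hε u
    simp only []
    rw [epsGaussianDensity_eq hε, ← ENNReal.ofReal_mul (by positivity),
      ← ENNReal.ofReal_mul (by positivity), add_mul, Real.exp_add]
    congr 1
    ring
  rw [epsGaussianLaw, lintegral_withDensity_eq_lintegral_mul _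
    (measurable_epsGaussianDensity hlam hε m).ennreal_ofReal (by fun_prop)]
  simp only [Pi.mul_apply, h]
  rw [lintegral_const_mul' _ _ ENNReal.ofReal_ne_top, lintegral_exp_mul_baseDensity hlam hε hθ,
    ← ENNReal.ofReal_mul (by positivity), ← Real.exp_add]
  congr 2
  field_simp
  ring

theorem isProbabilityMeasure_epsGaussianLaw (hlam : 0 < lam) (hε : 0 < ε) (m : ℝ) :
    IsProbabilityMeasure (epsGaussianLaw lam ε m) := by
  have h := lintegral_exp_epsGaussianLaw hlam hε m (θ := 0)
    (by rw [add_zero]; exact canonicalParam_sq_lt hlam hε m)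
  rw [add_zero, sq_sub_canonicalParam_sq lam hε, Real.sqrt_sq (by positivity)] at h
  exact ⟨by simpa using h⟩

theorem eventually_canonicalParam_add_sq_lt (hlam : 0 < lam) (hε : 0 < ε) (m : ℝ) :
    ∀ᶠ θ in 𝓝 (0 : ℝ), ε * (canonicalParam lam ε m + θ) ^ 2 < lam ^ 2 := by
  have hc : Continuous fun θ : ℝ => ε * (canonicalParam lam ε m + θ) ^ 2 := by fun_prop
  refine hc.continuousAt.eventually_lt continuousAt_const ?_
  rw [add_zero]
  exact canonicalParam_sq_lt hlam hε m

/-- The law with parameters `(λ, ε, m)` is the `n`-th convolution power of the law of the same type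
with parameters `(nλ, n²ε, m/n)`, which has the same canonical parameter. -/
theorem convPow_epsGaussianLaw (hlam : 0 < lam) (hε : 0 < ε) (m : ℝ) {n : ℕ} (hn : 1 ≤ n) :
    convPow (epsGaussianLaw (n * lam) (n ^ 2 * ε) (m / n)) n = epsGaussianLaw lam ε m := by
  have hn0 : (0 : ℝ) < n := by exact_mod_cast hn
  have hlam' : 0 < n * lam := by positivity
  have hε' : 0 < n ^ 2 * ε := by positivity
  have hm : n ^ 2 * ε * (m / n) ^ 2 = ε * m ^ 2 := by field_simp
  have hβ : canonicalParam (n * lam) (n ^ 2 * ε) (m / n) = canonicalParam lam ε m := by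
    rw [canonicalParam, canonicalParam, hm]
    field_simp
  have := isProbabilityMeasure_epsGaussianLaw hlam hε m
  have := isProbabilityMeasure_epsGaussianLaw hlam' hε' (m / n)
  have := isProbabilityMeasure_convPow (ν := epsGaussianLaw (n * lam) (n ^ 2 * ε) (m / n)) n
  have hpow : ∀ θ, ε * (canonicalParam lam ε m + θ) ^ 2 < lam ^ 2 →
      ∫⁻ u, ENNReal.ofReal (Real.exp (θ * u))
        ∂(convPow (epsGaussianLaw (n * lam) (n ^ 2 * ε) (m / n)) n) =
      ∫⁻ u, ENNReal.ofReal (Real.exp (θ * u)) ∂(epsGaussianLaw lam ε m) := by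
    intro θ hθ
    have hs : (n * lam) ^ 2 - n ^ 2 * ε * (canonicalParam lam ε m + θ) ^ 2 =
        n ^ 2 * (lam ^ 2 - ε * (canonicalParam lam ε m + θ) ^ 2) := by ring
    rw [lintegral_exp_convPow, lintegral_exp_epsGaussianLaw hlam' hε' (m / n) (by
        rw [hβ]
        have : 0 < n ^ 2 * (lam ^ 2 - ε * (canonicalParam lam ε m + θ) ^ 2) :=
          mul_pos (by positivity) (by linarith)
        linarith), lintegral_exp_epsGaussianLaw hlam hε m hθ,
      ← ENNReal.ofReal_pow (Real.exp_pos _).le, ← Real.exp_nat_mul, hβ, hm, hs,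
      Real.sqrt_mul (by positivity), Real.sqrt_sq hn0.le]
    congr 2
    field_simp
  have hev := eventually_canonicalParam_add_sq_lt hlam hε m
  refine ext_of_lintegral_exp_eq (hev.mono fun θ hθ => ?_) (hev.mono hpow)
  rw [hpow θ hθ, lintegral_exp_epsGaussianLaw hlam hε m hθ]
  exact ENNReal.ofReal_ne_top

theorem infinitelyDivisible_epsGaussianLaw (hlam : 0 < lam) (hε : 0 < ε) (m : ℝ) :
    InfinitelyDivisible (epsGaussianLaw lam ε m) := by
  refine ⟨isProbabilityMeasure_epsGaussianLaw hlam hε m, fun n hn => ?_⟩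
  have hn0 : (0 : ℝ) < n := by exact_mod_cast hn
  exact ⟨_, isProbabilityMeasure_epsGaussianLaw (by positivity) (by positivity) (m / n),
    convPow_epsGaussianLaw hlam hε m hn⟩

theorem canonicalParam_zero (lam ε : ℝ) : canonicalParam lam ε 0 = 0 := by simp [canonicalParam]

theorem integrable_exp_epsGaussianLaw_zero (hlam : 0 < lam) (hε : 0 < ε) {θ : ℝ}
    (hθ : ε * θ ^ 2 < lam ^ 2) :
    Integrable (fun u : ℝ => Real.exp (θ * u)) (epsGaussianLaw lam ε 0) := by
  refine integrable_exp_of_lintegral_ne_top ?_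
  rw [lintegral_exp_epsGaussianLaw hlam hε 0 (by rwa [canonicalParam_zero, zero_add])]
  exact ENNReal.ofReal_ne_top

theorem mgf_epsGaussianLaw_zero (hlam : 0 < lam) (hε : 0 < ε) {θ : ℝ}
    (hθ : ε * θ ^ 2 < lam ^ 2) :
    mgf id (epsGaussianLaw lam ε 0) θ =
      Real.exp ((lam - √(lam ^ 2 - ε * θ ^ 2)) / ε) := by
  simp only [mgf, id]
  rw [integral_eq_lintegral_of_nonneg_ae (Eventually.of_forall fun u => (Real.exp_pos _).le)
      (by fun_prop),
    lintegral_exp_epsGaussianLaw hlam hε 0 (by rwa [canonicalParam_zero, zero_add]),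
    ENNReal.toReal_ofReal (Real.exp_pos _).le, canonicalParam_zero]
  simp

/-- All laws with given `λ` and `ε` are exponential tilts of the one with mean `0`. -/
theorem tilted_epsGaussianLaw_zero (hlam : 0 < lam) (hε : 0 < ε) (m : ℝ) :
    (epsGaussianLaw lam ε 0).tilted (fun u => canonicalParam lam ε m * u) =
      epsGaussianLaw lam ε m := by
  have hmgf := mgf_epsGaussianLaw_zero hlam hε (canonicalParam_sq_lt hlam hε m)
  simp only [mgf, id] at hmgf
  rw [Measure.tilted, hmgf, sq_sub_canonicalParam_sq lam hε, Real.sqrt_sq (by positivity)]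
  nth_rewrite 1 [epsGaussianLaw]
  rw [← withDensity_mul _ (measurable_epsGaussianDensity hlam hε 0).ennreal_ofReal (by fun_prop),
    epsGaussianLaw]
  congr 1
  ext u : 1
  have hb := baseDensity_nonneg hlam hε u
  simp only [Pi.mul_apply]
  rw [epsGaussianDensity_eq hε, epsGaussianDensity_eq hε, canonicalParam_zero,
    ← ENNReal.ofReal_mul (by positivity), ← Real.exp_sub]
  congr 1
  rw [zero_mul, Real.exp_zero, one_mul, mul_right_comm, ← Real.exp_add, ← mul_assoc,
    ← Real.exp_add]
  congr 2
  norm_num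
  field_simp
  ring

/-! ### Exponential families -/

theorem isOpen_paramSet (C D : EReal) : IsOpen (paramSet C D) :=
  isOpen_Ioo.preimage continuous_coe_real_ereal

theorem convex_paramSet (C D : EReal) : Convex ℝ (paramSet C D) := by
  refine OrdConnected.convex ⟨fun x hx y hy z hz => ⟨?_, ?_⟩⟩
  · exact hx.1.trans_le (EReal.coe_le_coe_iff.2 hz.1)
  · exact (EReal.coe_le_coe_iff.2 hz.2).trans_lt hy.2

/-- A function on the parameter set with vanishing derivative is constant. -/
theorem eq_of_hasDerivAt_zero {C D : EReal} {f : ℝ → ℝ}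
    (hf : ∀ θ ∈ paramSet C D, HasDerivAt f 0 θ) {θ η : ℝ} (hθ : θ ∈ paramSet C D)
    (hη : η ∈ paramSet C D) : f θ = f η :=
  (convex_paramSet C D).is_const_of_fderivWithin_eq_zero (𝕜 := ℝ)
    (fun z hz => (hf z hz).differentiableAt.differentiableWithinAt)
    (fun z hz => by
      rw [fderivWithin_of_isOpen (isOpen_paramSet C D) hz]
      ext
      simpa using (hf z hz).deriv) hθ hη

variable {μ : Measure ℝ} {C D : EReal}

theorem IsGenerator.ne_zero (h : IsGenerator μ C D) : NeZero μ :=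
  ⟨fun h0 => h.nondegenerate 0 (by simp [h0])⟩

theorem IsGenerator.mem_interior (h : IsGenerator μ C D) {θ : ℝ} (hθ : θ ∈ paramSet C D) :
    θ ∈ interior (integrableExpSet id μ) :=
  interior_maximal (fun η hη => h.expMoment η hη) (isOpen_paramSet C D) hθ

theorem IsGenerator.isProbabilityMeasure_member (h : IsGenerator μ C D) {θ : ℝ}
    (hθ : θ ∈ paramSet C D) : IsProbabilityMeasure (member μ θ) :=
  have := h.ne_zero
  isProbabilityMeasure_tilted (h.expMoment θ hθ)

theorem IsGenerator.hasDerivAt_kappa (h : IsGenerator μ C D) {θ : ℝ} (hθ : θ ∈ paramSet C D) :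
    HasDerivAt (kappa μ) (deriv (kappa μ) θ) θ :=
  (analyticAt_cgf (h.mem_interior hθ)).differentiableAt.hasDerivAt

/-- `κ''(θ)` is the variance of `P_θ`, whose mean is `κ'(θ)`. -/
theorem IsGenerator.hasDerivAt_deriv_kappa (h : IsGenerator μ C D) {θ : ℝ}
    (hθ : θ ∈ paramSet C D) :
    HasDerivAt (deriv (kappa μ)) (∫ u, (u - deriv (kappa μ) θ) ^ 2 ∂(member μ θ)) θ := by
  have hi := h.mem_interior hθ
  have hv := variance_tilted_mul hi
  rw [variance_eq_integral (memLp_tilted_mul hi 1).aestronglyMeasurable.aemeasurable,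
    integral_tilted_mul_self hi] at hv
  have hd := (analyticAt_cgf hi).deriv.differentiableAt.hasDerivAt
  refine hd.congr_deriv ?_
  rw [iteratedDeriv_succ, iteratedDeriv_one] at hv
  exact hv.symm

/-- The variance of a member is positive, since `μ` and the member have the same null sets and `μ`
is not concentrated on a point. -/
theorem IsGenerator.integral_sq_pos (h : IsGenerator μ C D) {θ : ℝ} (hθ : θ ∈ paramSet C D) :
    0 < ∫ u, (u - deriv (kappa μ) θ) ^ 2 ∂(member μ θ) := by
  have hi := h.mem_interior hθ
  have := h.isProbabilityMeasure_member hθ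
  have hL : MemLp id 2 (member μ θ) := memLp_tilted_mul hi 2
  have hv := variance_eq_integral hL.aemeasurable
  have hm : (member μ θ)[id] = deriv (kappa μ) θ := integral_tilted_mul_self hi
  rw [hm] at hv
  refine lt_of_le_of_ne (hv ▸ variance_nonneg id _) fun h0 => ?_
  have hae := ae_eq_integral_of_variance_eq_zero hL (hv.trans h0.symm)
  have hac : μ ≪ member μ θ := absolutelyContinuous_tilted (h.expMoment θ hθ)
  exact h.nondegenerate _ (hac.ae_le hae)

theorem IsGenerator.injOn_deriv_kappa (h : IsGenerator μ C D) :
    InjOn (deriv (kappa μ)) (paramSet C D) := by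
  refine StrictMonoOn.injOn (strictMonoOn_of_deriv_pos (convex_paramSet C D)
    (fun θ hθ => (h.hasDerivAt_deriv_kappa hθ).continuousAt.continuousWithinAt) fun θ hθ => ?_)
  rw [(h.hasDerivAt_deriv_kappa (interior_subset hθ)).deriv]
  exact h.integral_sq_pos (interior_subset hθ)

theorem psi_mem {m : ℝ} (hm : m ∈ meanDomain μ C D) : psi μ C D m ∈ paramSet C D :=
  Function.invFunOn_mem hm

theorem deriv_kappa_psi {m : ℝ} (hm : m ∈ meanDomain μ C D) :
    deriv (kappa μ) (psi μ C D m) = m :=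
  Function.invFunOn_eq hm

theorem IsGenerator.psi_deriv_kappa (h : IsGenerator μ C D) {θ : ℝ} (hθ : θ ∈ paramSet C D) :
    psi μ C D (deriv (kappa μ) θ) = θ :=
  h.injOn_deriv_kappa (psi_mem ⟨θ, hθ, rfl⟩) hθ (deriv_kappa_psi ⟨θ, hθ, rfl⟩)

theorem IsGenerator.lintegral_exp_member (h : IsGenerator μ C D) {c θ : ℝ}
    (hc : c ∈ paramSet C D) (hθ : c + θ ∈ paramSet C D) :
    ∫⁻ u, ENNReal.ofReal (Real.exp (θ * u)) ∂(member μ c) =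
      ENNReal.ofReal (Real.exp (kappa μ (c + θ) - kappa μ c)) := by
  have := h.ne_zero
  have hadd : (fun u : ℝ => Real.exp (c * u) • Real.exp (θ * u)) =
      fun u => Real.exp ((c + θ) * u) := by
    ext u
    rw [smul_eq_mul, ← Real.exp_add, add_mul]
  have hint : Integrable (fun u : ℝ => Real.exp (θ * u)) (member μ c) := by
    rw [member, integrable_tilted_iff (h.expMoment c hc), hadd]
    exact h.expMoment _ hθ
  rw [← ofReal_integral_eq_lintegral_ofReal hint (Eventually.of_forall fun u => (Real.exp_pos _).le),
    Real.exp_sub, kappa, exp_cgf (X := id) (h.expMoment _ hθ), exp_cgf (X := id) (h.expMoment _ hc), member,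
    integral_exp_tilted]
  simp only [mgf, id, Pi.add_apply, add_mul]

/-! ### The variance function determines the family -/

/-- The derivative of the cumulant function `(λ - √(λ² - εθ²)) / ε` of the law with mean `0`; it is
the inverse of `canonicalParam`. -/
noncomputable def meanOfParam (lam ε θ : ℝ) : ℝ := θ / √(lam ^ 2 - ε * θ ^ 2)

theorem meanOfParam_canonicalParam (hlam : 0 < lam) (hε : 0 < ε) (m : ℝ) :
    meanOfParam lam ε (canonicalParam lam ε m) = m := by
  have : 0 < √(1 + ε * m ^ 2) := by positivity
  rw [meanOfParam, sq_sub_canonicalParam_sq lam hε, Real.sqrt_sq (by positivity), canonicalParam]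
  field_simp

theorem canonicalParam_meanOfParam (hlam : 0 < lam) {θ : ℝ} (hθ : ε * θ ^ 2 < lam ^ 2) :
    canonicalParam lam ε (meanOfParam lam ε θ) = θ := by
  have hs : 0 < lam ^ 2 - ε * θ ^ 2 := by linarith
  have hs' : 0 < √(lam ^ 2 - ε * θ ^ 2) := Real.sqrt_pos.2 hs
  have e : 1 + ε * meanOfParam lam ε θ ^ 2 = (lam / √(lam ^ 2 - ε * θ ^ 2)) ^ 2 := by
    rw [meanOfParam, div_pow, div_pow, Real.sq_sqrt hs.le]
    field_simp
    ring
  rw [canonicalParam, e, Real.sqrt_sq (by positivity), meanOfParam]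
  generalize √(lam ^ 2 - ε * θ ^ 2) = s at hs'
  field_simp

theorem hasDerivAt_canonicalParam (lam : ℝ) (hε : 0 < ε) (m : ℝ) :
    HasDerivAt (canonicalParam lam ε) (lam / ((1 + ε * m ^ 2) * √(1 + ε * m ^ 2))) m := by
  have hw : 0 < 1 + ε * m ^ 2 := by positivity
  have hs : √(1 + ε * m ^ 2) ≠ 0 := (Real.sqrt_pos.2 hw).ne'
  have h1 : HasDerivAt (fun m : ℝ => 1 + ε * m ^ 2) (ε * (2 * m)) m := by
    simpa using ((hasDerivAt_pow 2 m).const_mul ε).const_add 1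
  refine (((hasDerivAt_id m).const_mul lam).div (h1.sqrt hw.ne') hs).congr_deriv ?_
  have hsq := Real.sq_sqrt hw.le
  simp only [id]
  rw [hsq]
  field_simp
  rw [hsq]
  ring

theorem hasDerivAt_cumulant (hε : 0 < ε) {θ : ℝ} (hθ : ε * θ ^ 2 < lam ^ 2) :
    HasDerivAt (fun θ => (lam - √(lam ^ 2 - ε * θ ^ 2)) / ε) (meanOfParam lam ε θ) θ := by
  have hs : 0 < lam ^ 2 - ε * θ ^ 2 := by linarith
  have hs' : √(lam ^ 2 - ε * θ ^ 2) ≠ 0 := (Real.sqrt_pos.2 hs).ne'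
  have h1 : HasDerivAt (fun θ : ℝ => lam ^ 2 - ε * θ ^ 2) (-(ε * (2 * θ))) θ := by
    simpa using ((hasDerivAt_pow 2 θ).const_mul ε).const_sub (lam ^ 2)
  refine (((h1.sqrt hs.ne').const_sub lam).div_const ε).congr_deriv ?_
  rw [meanOfParam]
  field_simp

theorem hasDerivAt_meanOfParam (hlam : 0 < lam) (hε : 0 < ε) (m : ℝ) :
    HasDerivAt (meanOfParam lam ε) (epsGaussianVariance lam ε m) (canonicalParam lam ε m) := by
  have hlt := canonicalParam_sq_lt hlam hε m
  have hs : 0 < lam ^ 2 - ε * canonicalParam lam ε m ^ 2 := by linarith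
  set θ := canonicalParam lam ε m with hθ
  have h1 : HasDerivAt (fun θ : ℝ => lam ^ 2 - ε * θ ^ 2) (-(ε * (2 * θ))) θ := by
    simpa using ((hasDerivAt_pow 2 θ).const_mul ε).const_sub (lam ^ 2)
  refine ((hasDerivAt_id θ).div (h1.sqrt hs.ne') (Real.sqrt_pos.2 hs).ne').congr_deriv ?_
  have hw : 0 < 1 + ε * m ^ 2 := by positivity
  have hsq := Real.sq_sqrt hw.le
  have hw' : 0 < √(1 + ε * m ^ 2) := Real.sqrt_pos.2 hw
  simp only [id]
  rw [hθ, sq_sub_canonicalParam_sq lam hε, Real.sqrt_sq (by positivity), epsGaussianVariance,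
    canonicalParam]
  nth_rewrite 7 [← hsq]
  field_simp
  rw [hsq]
  ring

/-- The variance function gives `κ'' = V ∘ κ'`, and `canonicalParam` is a primitive of `1 / V`; hence
`canonicalParam ∘ κ'` is a translation. -/
theorem canonicalParam_deriv_kappa (hlam : 0 < lam) (hε : 0 < ε)
    (h : HasVarianceFunction μ C D Set.univ (epsGaussianVariance lam ε)) {θ : ℝ}
    (hθ : θ ∈ paramSet C D) :
    canonicalParam lam ε (deriv (kappa μ) θ) = θ - psi μ C D 0 := by
  have hdom : ∀ m, m ∈ meanDomain μ C D := fun m => h.meanDomain_eq ▸ mem_univ m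
  have hd : ∀ η ∈ paramSet C D,
      HasDerivAt (fun η => canonicalParam lam ε (deriv (kappa μ) η) - η) 0 η := by
    intro η hη
    have hV := h.variance_eq (deriv (kappa μ) η) (mem_univ _)
    rw [varianceFunction, meanMember, h.toIsGenerator.psi_deriv_kappa hη] at hV
    have h1 := h.toIsGenerator.hasDerivAt_deriv_kappa hη
    rw [hV] at h1
    refine (((hasDerivAt_canonicalParam lam hε _).comp η h1).sub (hasDerivAt_id η)).congr_deriv ?_
    have : 0 < √(1 + ε * deriv (kappa μ) η ^ 2) := by positivity
    rw [epsGaussianVariance]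
    field_simp
    norm_num
  have h0 := eq_of_hasDerivAt_zero hd hθ (psi_mem (hdom 0))
  simp only [deriv_kappa_psi (hdom 0), canonicalParam_zero] at h0
  linarith

theorem psi_eq (hlam : 0 < lam) (hε : 0 < ε)
    (h : HasVarianceFunction μ C D Set.univ (epsGaussianVariance lam ε)) (m : ℝ) :
    psi μ C D m = psi μ C D 0 + canonicalParam lam ε m := by
  have hm : m ∈ meanDomain μ C D := h.meanDomain_eq ▸ mem_univ m
  have h1 := canonicalParam_deriv_kappa hlam hε h (psi_mem hm)
  rw [deriv_kappa_psi hm] at h1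
  linarith

/-- The parameter set is the translate by `ψ(0)` of `{θ | εθ² < λ²}`: the domain of the means
being all of `ℝ`, it can be neither smaller nor larger. -/
theorem mem_paramSet_iff (hlam : 0 < lam) (hε : 0 < ε)
    (h : HasVarianceFunction μ C D Set.univ (epsGaussianVariance lam ε)) (θ : ℝ) :
    psi μ C D 0 + θ ∈ paramSet C D ↔ ε * θ ^ 2 < lam ^ 2 := by
  constructor
  · intro hθ
    have h1 := canonicalParam_deriv_kappa hlam hε h hθ
    rw [add_sub_cancel_left] at h1
    rw [← h1]
    exact canonicalParam_sq_lt hlam hε _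
  · intro hθ
    have hm : meanOfParam lam ε θ ∈ meanDomain μ C D := h.meanDomain_eq ▸ mem_univ _
    have h1 := psi_mem hm
    rwa [psi_eq hlam hε h, canonicalParam_meanOfParam hlam hθ] at h1

/-- Integrating `κ' = meanOfParam` (up to the translation of the parameter) gives the cumulant
function of the member with mean `0`. -/
theorem kappa_eq (hlam : 0 < lam) (hε : 0 < ε)
    (h : HasVarianceFunction μ C D Set.univ (epsGaussianVariance lam ε)) {θ : ℝ}
    (hθ : ε * θ ^ 2 < lam ^ 2) :
    kappa μ (psi μ C D 0 + θ) - kappa μ (psi μ C D 0) =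
      (lam - √(lam ^ 2 - ε * θ ^ 2)) / ε := by
  set c := psi μ C D 0 with hc
  have hd : ∀ η ∈ paramSet C D,
      HasDerivAt (fun η => kappa μ η - (lam - √(lam ^ 2 - ε * (η - c) ^ 2)) / ε) 0 η := by
    intro η hη
    have hη' : ε * (η - c) ^ 2 < lam ^ 2 :=
      (mem_paramSet_iff hlam hε h (η - c)).1 (by rwa [← hc, add_sub_cancel])
    refine ((h.toIsGenerator.hasDerivAt_kappa hη).sub
      ((hasDerivAt_cumulant hε hη').comp_sub_const η c)).congr_deriv ?_
    rw [← canonicalParam_deriv_kappa hlam hε h hη, meanOfParam_canonicalParam hlam hε, sub_self]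
  have h0 : c ∈ paramSet C D := by
    simpa using (mem_paramSet_iff hlam hε h 0).2 (by simpa using pow_pos hlam 2)
  have h1 := eq_of_hasDerivAt_zero hd ((mem_paramSet_iff hlam hε h θ).2 hθ) h0
  simp only [← hc, add_sub_cancel_left, sub_self] at h1
  have h2 : √(lam ^ 2 - ε * 0 ^ 2) = lam := by simp [Real.sqrt_sq hlam.le]
  rw [h2, sub_self, zero_div, sub_zero] at h1
  linarith

theorem member_psi_zero (hlam : 0 < lam) (hε : 0 < ε)
    (h : HasVarianceFunction μ C D Set.univ (epsGaussianVariance lam ε)) :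
    member μ (psi μ C D 0) = epsGaussianLaw lam ε 0 := by
  have h0 : psi μ C D 0 ∈ paramSet C D := by
    simpa using (mem_paramSet_iff hlam hε h 0).2 (by simpa using pow_pos hlam 2)
  have := h.toIsGenerator.isProbabilityMeasure_member h0
  have := isProbabilityMeasure_epsGaussianLaw hlam hε 0
  have hev := eventually_canonicalParam_add_sq_lt hlam hε 0
  have hL : ∀ θ, ε * (canonicalParam lam ε 0 + θ) ^ 2 < lam ^ 2 →
      ∫⁻ u, ENNReal.ofReal (Real.exp (θ * u)) ∂(member μ (psi μ C D 0)) =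
        ∫⁻ u, ENNReal.ofReal (Real.exp (θ * u)) ∂(epsGaussianLaw lam ε 0) := by
    intro θ hθ
    have hθ' : ε * θ ^ 2 < lam ^ 2 := by rwa [canonicalParam_zero, zero_add] at hθ
    rw [lintegral_exp_epsGaussianLaw hlam hε 0 hθ, h.toIsGenerator.lintegral_exp_member h0
      ((mem_paramSet_iff hlam hε h θ).2 hθ'), kappa_eq hlam hε h hθ', canonicalParam_zero]
    simp
  refine ext_of_lintegral_exp_eq (hev.mono fun θ hθ => ?_) (hev.mono hL)
  rw [hL θ hθ, lintegral_exp_epsGaussianLaw hlam hε 0 hθ]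
  exact ENNReal.ofReal_ne_top

theorem meanMember_eq (hlam : 0 < lam) (hε : 0 < ε)
    (h : HasVarianceFunction μ C D Set.univ (epsGaussianVariance lam ε)) (m : ℝ) :
    meanMember μ C D m = epsGaussianLaw lam ε m := by
  have h0 : psi μ C D 0 ∈ paramSet C D := psi_mem (h.meanDomain_eq ▸ mem_univ _)
  rw [← tilted_epsGaussianLaw_zero hlam hε, ← member_psi_zero hlam hε h, member,
    tilted_tilted (h.expMoment _ h0), meanMember, member, psi_eq hlam hε h]
  congr 1
  ext u
  simp only [Pi.add_apply, add_mul]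

theorem expFamily_eq (hlam : 0 < lam) (hε : 0 < ε)
    (h : HasVarianceFunction μ C D Set.univ (epsGaussianVariance lam ε)) :
    expFamily μ C D = Set.range (epsGaussianLaw lam ε) := by
  ext P
  constructor
  · rintro ⟨θ, hθ, rfl⟩
    refine ⟨deriv (kappa μ) θ, ?_⟩
    rw [← meanMember_eq hlam hε h, meanMember, h.toIsGenerator.psi_deriv_kappa hθ]
  · rintro ⟨m, rfl⟩
    exact ⟨psi μ C D m, psi_mem (h.meanDomain_eq ▸ mem_univ m), meanMember_eq hlam hε h m⟩

/-! ### Existence -/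

theorem mem_paramSet_symm_iff (hlam : 0 < lam) (hε : 0 < ε) (θ : ℝ) :
    θ ∈ paramSet ((-(lam / √ε) : ℝ) : EReal) ((lam / √ε : ℝ) : EReal) ↔ ε * θ ^ 2 < lam ^ 2 := by
  have hs : 0 < √ε := Real.sqrt_pos.2 hε
  simp only [paramSet, mem_ofPred_eq, EReal.coe_lt_coe_iff]
  rw [← abs_lt, ← sq_lt_sq₀ (abs_nonneg θ) (by positivity), sq_abs, div_pow, Real.sq_sqrt hε.le,
    lt_div_iff₀ hε, mul_comm]

theorem isGenerator_epsGaussianLaw (hlam : 0 < lam) (hε : 0 < ε) :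
    IsGenerator (epsGaussianLaw lam ε 0) ((-(lam / √ε) : ℝ) : EReal) ((lam / √ε : ℝ) : EReal) where
  sigmaFinite := have := isProbabilityMeasure_epsGaussianLaw hlam hε 0; inferInstance
  nondegenerate a ha := by
    have := isProbabilityMeasure_epsGaussianLaw hlam hε 0
    have h1 : epsGaussianLaw lam ε 0 {a} = 0 :=
      withDensity_absolutelyContinuous _ _ (measure_singleton a)
    have h2 := measure_add_measure_compl (μ := epsGaussianLaw lam ε 0) (measurableSet_singleton a)
    rw [h1, ha, measure_univ] at h2
    simp at h2
  interval := by
    rw [EReal.coe_lt_coe_iff]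
    have : 0 < lam / √ε := by positivity
    linarith
  expMoment θ hθ :=
    integrable_exp_epsGaussianLaw_zero hlam hε ((mem_paramSet_symm_iff hlam hε θ).1 hθ)

theorem deriv_kappa_epsGaussianLaw (hlam : 0 < lam) (hε : 0 < ε) {θ : ℝ}
    (hθ : ε * θ ^ 2 < lam ^ 2) :
    deriv (kappa (epsGaussianLaw lam ε 0)) θ = meanOfParam lam ε θ := by
  refine ((hasDerivAt_cumulant hε hθ).congr_of_eventuallyEq ?_).deriv
  have hc : Continuous fun θ : ℝ => ε * θ ^ 2 := by fun_prop
  filter_upwards [hc.continuousAt.eventually_lt continuousAt_const hθ] with η hη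
  rw [kappa, cgf, mgf_epsGaussianLaw_zero hlam hε hη, Real.log_exp]

theorem hasVarianceFunction_epsGaussianLaw (hlam : 0 < lam) (hε : 0 < ε) :
    HasVarianceFunction (epsGaussianLaw lam ε 0) ((-(lam / √ε) : ℝ) : EReal)
      ((lam / √ε : ℝ) : EReal) Set.univ (epsGaussianVariance lam ε) := by
  have hG := isGenerator_epsGaussianLaw hlam hε
  have hmem := fun m => (mem_paramSet_symm_iff hlam hε (canonicalParam lam ε m)).2
    (canonicalParam_sq_lt hlam hε m)
  have hmean : ∀ m, deriv (kappa (epsGaussianLaw lam ε 0)) (canonicalParam lam ε m) = m := fun m => by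
    rw [deriv_kappa_epsGaussianLaw hlam hε (canonicalParam_sq_lt hlam hε m),
      meanOfParam_canonicalParam hlam hε]
  refine { hG with meanDomain_eq := ?_, variance_eq := fun m _ => ?_ }
  · exact eq_univ_of_forall fun m => ⟨canonicalParam lam ε m, hmem m, hmean m⟩
  · have hpsi := hG.psi_deriv_kappa (hmem m)
    rw [hmean] at hpsi
    have h1 := hG.hasDerivAt_deriv_kappa (hmem m)
    rw [hmean] at h1
    rw [varianceFunction, meanMember, hpsi]
    refine h1.unique ((hasDerivAt_meanOfParam hlam hε m).congr_of_eventuallyEq ?_)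
    filter_upwards [(isOpen_paramSet _ _).mem_nhds (hmem m)] with θ hθ
    exact deriv_kappa_epsGaussianLaw hlam hε ((mem_paramSet_symm_iff hlam hε θ).1 hθ)

end EpsGaussian

theorem theorem2p2 (lam ε : ℝ) (hlam : 0 < lam) (hε : 0 < ε) :
    (∃ (μ : Measure ℝ) (C D : EReal),
      EpsGaussian.HasVarianceFunction μ C D Set.univ (EpsGaussian.epsGaussianVariance lam ε)) ∧
    ∀ (μ : Measure ℝ) (C D : EReal),
      EpsGaussian.HasVarianceFunction μ C D Set.univ (EpsGaussian.epsGaussianVariance lam ε) →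
        EpsGaussian.expFamily μ C D = Set.range (EpsGaussian.epsGaussianLaw lam ε) ∧
        (∀ m : ℝ, EpsGaussian.meanMember μ C D m = EpsGaussian.epsGaussianLaw lam ε m) ∧
        (∀ P ∈ EpsGaussian.expFamily μ C D, EpsGaussian.InfinitelyDivisible P) := by
  refine ⟨⟨_, _, _, EpsGaussian.hasVarianceFunction_epsGaussianLaw hlam hε⟩, fun μ C D h =>
    ⟨EpsGaussian.expFamily_eq hlam hε h, EpsGaussian.meanMember_eq hlam hε h, fun P hP => ?_⟩⟩
  rw [EpsGaussian.expFamily_eq hlam hε h] at hP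
  obtain ⟨m, rfl⟩ := hP
  exact EpsGaussian.infinitelyDivisible_epsGaussianLaw hlam hε m
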